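/- Let $\mathbb{K}$ be an algebraically closed field of characteristic zero. For $f,g\in\mathbb{K}[[X,Y]]$ put $i_0(f,g)=\dim_{\mathbb{K}}\mathbb{K}[[X,Y]]/\langle f,g\rangle\in\{0,1,2,\dots\}\cup\{+\infty\}$. A Weierstrass polynomial is a monic $p=Y^m+a_{m-1}(X)Y^{m-1}+\dots+a_0(X)\in\mathbb{K}[[X]][Y]$ with $a_i(0)=0$ for all $i<m$. If $i_0(f,X)<+\infty$, there is a unique Weierstrass polynomial $f_1$ such that $f=u f_1$ for a unit $u\in\mathbb{K}[[X,Y]]$. For irreducible such $f$, the characteristic $\mathrm{Char}(f)=(h_1,\dots,h_s)$ is the increasing sequence of all the rational numbers $\operatorname{ord}(\alpha-\alpha')$, where $\alpha\neq\alpha'$ run over the roots of $f_1$ in $\bigcup_{m\ge1}\mathbb{K}[[X^{1/m}]]$ (the sequence is empty, $s=0$, when $f_1$ has degree $1$). Put $M_i=\mathbb{Z}+\mathbb{Z}h_1+\dots+\mathbb{Z}h_i$ for $0\le i\le s$, $n_i=[M_i:M_{i-1}]$ for $1\le i\le s$, $e_i=n_{i+1}\cdots n_s$ for $0\le i\le s$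 (so $e_s=1$), and $$q_s=\sum_{j=1}^{s}(e_{j-1}-e_j)h_j+e_sh_s \quad (s\ge 1),\qquad q_0=0 .$$ Theorem (Abhyankar–Moh). Let $f,g\in\mathbb{K}[[X,Y]]$. Assume that $f$ is irreducible, $i_0(f,X)=n<+\infty$ and $\mathrm{Char}(f)=(h_1,\dots,h_s)$. If $i_0(g,X)=n$ and $i_0(f,g)>n\,q_s$ (where $i_0(f,g)=+\infty$ is allowed), then $g$ is irreducible and $\mathrm{Char}(g)=\mathrm{Char}(f)$. -/

import Mathlib

/-!
Throughout, `K` is a field, `MvPowerSeries (Fin 2) K` is the ring `K[[X, Y]]` with `X` the variable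
of index `0` and `Y` the variable of index `1`, and `PowerSeries K` is the ring `K[[X]]`.
-/

noncomputable section

namespace AbhyankarMoh

/-- The bijection of `{0, 1}` with `Option Unit` that sends `0` (the index of `X`) to `some ()` and
`1` (the index of `Y`) to `none`. -/
def finTwoEquivOption : Fin 2 ≃ Option Unit :=
  (finSuccEquiv' (1 : Fin 2)).trans (Equiv.optionCongr (Equiv.ofUnique (Fin 1) Unit))

variable {K : Type*} [Field K]

/-- The standard identification of `K[[X, Y]]` with `K[[X]][[Y]]`: the expansion
`f = ∑ a_i(X) Y ^ i` of a power series in two variables in powers of `Y`. -/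
def expandY : MvPowerSeries (Fin 2) K ≃ₐ[K] PowerSeries (PowerSeries K) :=
  (MvPowerSeries.renameEquiv K finTwoEquivOption).trans (MvPowerSeries.optionEquivLeft Unit K)

/-- The coefficient of `X ^ j` in `a_i(X)` is the coefficient of `X ^ j * Y ^ i` in `f`. -/
theorem coeff_coeff_expandY (f : MvPowerSeries (Fin 2) K) (i j : ℕ) :
    PowerSeries.coeff j (PowerSeries.coeff i (expandY f)) =
      MvPowerSeries.coeff (Finsupp.single 0 j + Finsupp.single 1 i) f := by
  have h0 : finTwoEquivOption 0 = some () := by decide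
  have h1 : finTwoEquivOption 1 = none := by decide
  have h2 : Finsupp.optionElim i (Finsupp.single () j) =
      Finsupp.embDomain finTwoEquivOption.toEmbedding
        (Finsupp.single (0 : Fin 2) j + Finsupp.single 1 i) := by
    rw [Finsupp.embDomain_eq_mapDomain, Finsupp.mapDomain_add, Finsupp.mapDomain_single,
      Finsupp.mapDomain_single, Equiv.coe_toEmbedding, h0, h1]
    ext a
    cases a <;> simp
  have h3 := MvPowerSeries.coeff_coeff_optionEquivLeft
    (MvPowerSeries.rename finTwoEquivOption f) i (Finsupp.single () j)
  rw [h2] at h3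
  exact h3.trans (MvPowerSeries.coeff_embDomain_rename finTwoEquivOption.toEmbedding f _)

theorem expandY_X :
    expandY (MvPowerSeries.X 0 : MvPowerSeries (Fin 2) K) = PowerSeries.C PowerSeries.X :=
  (congrArg (MvPowerSeries.optionEquivLeft Unit K)
    (MvPowerSeries.rename_X finTwoEquivOption 0)).trans
      (MvPowerSeries.optionEquivLeft_X_some ())

theorem expandY_Y : expandY (MvPowerSeries.X 1 : MvPowerSeries (Fin 2) K) = PowerSeries.X :=
  (congrArg (MvPowerSeries.optionEquivLeft Unit K)
    (MvPowerSeries.rename_X finTwoEquivOption 1)).trans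
      MvPowerSeries.optionEquivLeft_X_none

/-- The intersection multiplicity `i₀(f, g) = dim_K K[[X, Y]] / (f, g)`, possibly infinite. -/
def intersectionNumber (f g : MvPowerSeries (Fin 2) K) : ℕ∞ :=
  Cardinal.toENat (Module.rank K (MvPowerSeries (Fin 2) K ⧸ Ideal.span {f, g}))

/-- `p ∈ K[[X]][Y]` is the Weierstrass polynomial of `f ∈ K[[X, Y]]`: it is monic, its other
coefficients vanish at `X = 0` (that is, lie in the maximal ideal of `K[[X]]`), and `f = u p` for
some unit `u` of `K[[X, Y]]`. -/
def IsWeierstrassPolynomialOf (p : Polynomial (PowerSeries K)) (f : MvPowerSeries (Fin 2) K) :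
    Prop :=
  ∃ u : PowerSeries (PowerSeries K), (expandY f).IsWeierstrassFactorization p u

/-- A Puiseux series: an element of `K[[X ^ (1 / m)]]` for some positive integer `m`, that is, a
formal sum of terms `c X ^ q` with all exponents `q` in `{0, 1 / m, 2 / m, …}`. -/
def IsPuiseux (α : HahnSeries ℚ K) : Prop :=
  ∃ m : ℕ, 0 < m ∧ ∀ q ∈ α.support, ∃ k : ℕ, q = (k : ℚ) / (m : ℚ)

/-- `Zer p`: the set of Puiseux series `α` with `p(X, α) = 0`. -/
def zer (p : Polynomial (PowerSeries K)) : Set (HahnSeries ℚ K) :=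
  {α | IsPuiseux α ∧ p.eval₂ (HahnSeries.ofPowerSeries ℚ K) α = 0}

/-- The contacts `ord (α - α')` of the pairs of distinct roots of `p`. -/
def contacts (p : Polynomial (PowerSeries K)) : Set ℚ :=
  {r | ∃ α ∈ zer p, ∃ α' ∈ zer p, α ≠ α' ∧ (α - α').order = r}

/-- `Char(f) = (h_1, …, h_s)`: the sequence is increasing, and its terms are the contacts of the
pairs of distinct roots of the Weierstrass polynomial of `f`. -/
def IsCharacteristic (f : MvPowerSeries (Fin 2) K) {s : ℕ} (h : Fin s → ℚ) : Prop :=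
  StrictMono h ∧
    ∃ p : Polynomial (PowerSeries K), IsWeierstrassPolynomialOf p f ∧ Set.range h = contacts p

variable {s : ℕ}

/-- The sequence `(h_1, …, h_s)` with its terms numbered from `1`; also `h_0 = 0`, and the terms
beyond `h_s`, which are never used, are set to `0`. -/
def term (h : Fin s → ℚ) : ℕ → ℚ
  | 0 => 0
  | i + 1 => if hi : i < s then h ⟨i, hi⟩ else 0

/-- The lattice `M_i = ℤ + ℤ h_1 + ⋯ + ℤ h_i`. -/
def lattice (h : Fin s → ℚ) (i : ℕ) : AddSubgroup ℚ :=
  AddSubgroup.closure (insert 1 (term h '' Set.Icc 1 i))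

/-- The index `n_i = [M_i : M_{i-1}]`, for `1 ≤ i ≤ s`. -/
def latticeIndex (h : Fin s → ℚ) (i : ℕ) : ℕ :=
  (lattice h (i - 1)).relIndex (lattice h i)

/-- The product `e_i = n_{i+1} ⋯ n_s`, for `0 ≤ i ≤ s`; in particular `e_s = 1`. -/
def indexProd (h : Fin s → ℚ) (i : ℕ) : ℕ :=
  ∏ j ∈ Finset.Icc (i + 1) s, latticeIndex h j

/-- The number `q_i = ∑_{j=1}^i (e_{j-1} - e_j) h_j + e_i h_i`, for `1 ≤ i ≤ s`; also `q_0 = 0`. -/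
def qExponent (h : Fin s → ℚ) (i : ℕ) : ℚ :=
  ∑ j ∈ Finset.Icc 1 i, ((indexProd h (j - 1) : ℚ) - (indexProd h j : ℚ)) * term h j
    + (indexProd h i : ℚ) * term h i

end AbhyankarMoh

end

/-! ### Colength and order in `K[[T]]`, and in finite free extensions of it. -/

noncomputable section

open PowerSeries

namespace AbhyankarMoh

variable {K : Type*} [Field K]

/-! Let `p`, `q` be the Weierstrass polynomials of `f`, `g`. By Newton-Puiseux (`splitsOverPuiseux`)
there is one `N` for which both split over `K[[t]]` after `X = t ^ N`. The group of `N`-th roots of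
unity acts by `t ↦ ζ t`. Irreducible monic polynomials are exactly those whose roots form one orbit,
each root being simple (`map_eq_orbitPoly_of_irreducible`, `irreducible_of_map_eq_orbitPoly`).

The hypothesis enters through the norm of `q` in `K[[X]][Y] / (p)`. Its order bounds the
intersection number from above (`intersectionNumber_le_order_norm`), and `N` times it is the sum of
`ord (x - b)` over the roots `x` of `p` and `b` of `q` (`order_norm_eq_sum`). Suppose that no `b` is
closer to some `x` than all the other conjugates of `x` are. For fixed `b`, let `y` be the root of
`p` closest to `b`. The ultrametric inequality gives `ord (x - b) ≤ ord (x - y)` for `x ≠ y`, while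
`ord (y - b) ≤ N h_s`. Exactly `e_{j-1} - e_j` conjugates have contact `h_j` with `y`, so the sum
over `x` is at most `N q_s`, and the norm has order at most `n q_s`. This is a contradiction
(`sum_order_sub_conjugates`, `exists_order_lt_order`).

So some `b` satisfies `ord (x - b) > ord (ζ x - x)` whenever `ζ x ≠ x`. Then `ζ b - b` and `ζ x - x`
have the same order, so the stabilizer of `b` lies in that of `x` and the orbit of `b` has at least
`n` elements. As `q` has degree `n`, its roots are exactly this orbit: `q` is irreducible and has
the contacts of `p` (`irreducible_and_contacts_eq`). -/

instance : IsAdicComplete (IsLocalRing.maximalIdeal (PowerSeries K)) (PowerSeries K) := by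
  rw [PowerSeries.maximalIdeal_eq_span_X]
  infer_instance

/-- The coefficients of a power series in degrees less than `n`. -/
def truncCoeffs (K : Type*) [Field K] (n : ℕ) : PowerSeries K →ₗ[K] (Fin n → K) :=
  LinearMap.pi fun i => PowerSeries.coeff (i : ℕ)

theorem truncCoeffs_surjective (n : ℕ) : Function.Surjective (truncCoeffs K n) := by
  intro v
  refine ⟨PowerSeries.mk fun i => if h : i < n then v ⟨i, h⟩ else 0, ?_⟩
  ext i
  simp [truncCoeffs]

theorem ker_truncCoeffs (n : ℕ) :
    LinearMap.ker (truncCoeffs K n) =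
      (Ideal.span {(X : PowerSeries K) ^ n}).restrictScalars K := by
  ext x
  rw [LinearMap.mem_ker, Submodule.restrictScalars_mem, Ideal.mem_span_singleton,
    PowerSeries.X_pow_dvd_iff, funext_iff]
  exact ⟨fun h m hm => h ⟨m, hm⟩, fun h i => h i i.2⟩

theorem span_eq_span_X_pow {h : PowerSeries K} (hh : h ≠ 0) :
    Ideal.span {h} = Ideal.span {(X : PowerSeries K) ^ h.order.toNat} := by
  rw [Ideal.span_singleton_eq_span_singleton]
  refine ⟨(PowerSeries.isUnit_divided_by_X_pow_order hh).unit⁻¹, ?_⟩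
  rw [Units.mul_inv_eq_iff_eq_mul]
  exact (PowerSeries.X_pow_order_mul_divXPowOrder).symm

/-- `K[[T]] / (T ^ n)` has the classes of `1, …, T ^ (n - 1)` as a basis. -/
def quotientSpanXPowEquiv (n : ℕ) :
    (PowerSeries K ⧸ Ideal.span {(X : PowerSeries K) ^ n}) ≃ₗ[K] (Fin n → K) :=
  (Submodule.Quotient.restrictScalarsEquiv K _).symm.trans <|
    (Submodule.quotEquivOfEq _ _ (ker_truncCoeffs n).symm).trans <|
    (truncCoeffs K n).quotKerEquivOfSurjective (truncCoeffs_surjective n)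

/-- The quotient `K[[T]] / (h)` as a vector space, for `h` nonzero. -/
def quotientSpanEquiv {h : PowerSeries K} (hh : h ≠ 0) :
    (PowerSeries K ⧸ Ideal.span {h}) ≃ₗ[K] (Fin h.order.toNat → K) :=
  (Ideal.quotientEquivAlgOfEq K (span_eq_span_X_pow hh)).toLinearEquiv.trans
    (quotientSpanXPowEquiv _)

theorem finite_quotient_span {h : PowerSeries K} (hh : h ≠ 0) :
    Module.Finite K (PowerSeries K ⧸ Ideal.span {h}) :=
  Module.Finite.equiv (quotientSpanEquiv hh).symm

theorem finrank_quotient_span {h : PowerSeries K} (hh : h ≠ 0) :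
    Module.finrank K (PowerSeries K ⧸ Ideal.span {h}) = h.order.toNat := by
  rw [(quotientSpanEquiv hh).finrank_eq, Module.finrank_fin_fun]

/-- A nonzero `h` is a unit times a power of `T`. For `h = 0` both sides are infinite, because
`K[[T]]` maps onto `K ^ n` for every `n`. -/
theorem toENat_rank_quotient_span (h : PowerSeries K) :
    Cardinal.toENat (Module.rank K (PowerSeries K ⧸ Ideal.span {h})) = h.order := by
  by_cases hh : h = 0
  · subst hh
    rw [PowerSeries.order_zero, ENat.eq_top_iff_forall_ge]
    intro n
    have h1 : Module.rank K (Fin n → K) ≤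
        Module.rank K (PowerSeries K ⧸ Ideal.span {(0 : PowerSeries K)}) := by
      have h2 : Submodule.restrictScalars K (Ideal.span {(0 : PowerSeries K)}) ≤
          LinearMap.ker (truncCoeffs K n) := by
        rw [Ideal.span_singleton_eq_bot.mpr rfl]
        simp
      refine LinearMap.rank_le_of_surjective
        (((Submodule.restrictScalars K (Ideal.span {(0 : PowerSeries K)})).liftQ
          (truncCoeffs K n) h2).comp
          (Submodule.Quotient.restrictScalarsEquiv K _).symm.toLinearMap) ?_
      intro v
      obtain ⟨x, rfl⟩ := truncCoeffs_surjective n v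
      exact ⟨Ideal.Quotient.mk _ x, rfl⟩
    have h3 := (Cardinal.toENat.monotone' h1)
    simpa using h3
  · have := finite_quotient_span hh
    rw [← Module.finrank_eq_rank, finrank_quotient_span hh, Cardinal.toENat_nat,
      PowerSeries.coe_toNat_order hh]

section Norm

variable {S : Type*} [CommRing S] [IsDomain S] [Algebra K S] [Algebra (PowerSeries K) S]
  [IsScalarTower K (PowerSeries K) S] {ι : Type*} [Fintype ι]

/-- By the Smith normal form over the principal ideal domain `K[[X]]`, the quotient is a direct sum
of modules `K[[X]] / (d_i)`, and the product of the `d_i` is associated to the norm. -/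
theorem finrank_quotient_span_eq_order_norm (b : Module.Basis ι (PowerSeries K) S) {x : S}
    (hx : x ≠ 0) :
    Module.Finite K (S ⧸ Ideal.span {x}) ∧
    (Module.finrank K (S ⧸ Ideal.span {x}) : ℕ∞) = (Algebra.norm (PowerSeries K) x).order := by
  have h := Ideal.span_singleton_eq_bot.not.2 hx
  have hs := fun i => Ideal.smithCoeffs_ne_zero b _ h i
  have hf := fun i => finite_quotient_span (hs i)
  refine ⟨Module.Finite.equiv
    ((Ideal.span {x}).quotientEquivPiSpan b h |>.restrictScalars K).symm, ?_⟩
  rw [Ideal.finrank_quotient_eq_sum K h b]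
  obtain ⟨u, hu⟩ := associated_norm_prod_smith b hx
  have h1 : (Algebra.norm (PowerSeries K) x).order =
      (∏ i, Ideal.smithCoeffs b _ h i).order := by
    rw [← hu, PowerSeries.order_mul, PowerSeries.order_zero_of_unit u.isUnit, add_zero]
  rw [h1, PowerSeries.order_prod, Nat.cast_sum]
  refine Finset.sum_congr rfl fun i _ => ?_
  rw [finrank_quotient_span (hs i), PowerSeries.coe_toNat_order (hs i)]

end Norm

/-! ### The norm as a product over roots. -/

section Vandermonde

variable {R B : Type*} [CommRing R] [CommRing B] [IsDomain B]

/-- The norm of the class of `q` modulo a monic polynomial `p` with distinct roots is the product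
of the values of `q` at the roots of `p`. -/
theorem map_norm_mk_eq_prod (φ : R →+* B) {p : Polynomial R} (hp : p.Monic)
    (a : Fin p.natDegree → B) (ha : Function.Injective a) (hroot : ∀ i, p.eval₂ φ (a i) = 0)
    (q : Polynomial R) :
    φ (Algebra.norm R (AdjoinRoot.mk p q)) = ∏ i, q.eval₂ φ (a i) := by
  let P := AdjoinRoot.powerBasis' hp
  let l : Fin p.natDegree → (AdjoinRoot p →+* B) := fun i => AdjoinRoot.lift φ (a i) (hroot i)
  let a' : Fin P.dim → B := a
  -- The rows of the Vandermonde matrix are left eigenvectors of multiplication by `q`: applying the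
  -- evaluation at `a i` to the expansion of `q * Y ^ j` in the power basis gives each entry.
  have key : Matrix.vandermonde a' * (Algebra.leftMulMatrix P.basis (AdjoinRoot.mk p q)).map φ =
      Matrix.diagonal (fun i : Fin P.dim => q.eval₂ φ (a' i)) * Matrix.vandermonde a' := by
    ext i j
    rw [Matrix.diagonal_mul, Matrix.mul_apply]
    have h1 := congrArg (l i) (P.basis.sum_repr (AdjoinRoot.mk p q * P.basis j))
    simp only [map_sum, map_mul, Algebra.smul_def, PowerBasis.coe_basis, map_pow] at h1
    have hg : l i P.gen = a' i := by
      change l i (AdjoinRoot.root p) = a i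
      simp [l]
    have hq : l i (AdjoinRoot.mk p q) = q.eval₂ φ (a' i) := by
      simp [l, a']
    rw [hg, hq] at h1
    rw [Matrix.vandermonde_apply, ← h1]
    refine Finset.sum_congr rfl fun k _ => ?_
    rw [Matrix.vandermonde_apply, Matrix.map_apply, Algebra.leftMulMatrix_eq_repr_mul, mul_comm]
    congr 1
    rw [PowerBasis.coe_basis]
    simp [l, AdjoinRoot.algebraMap_eq]
  have h2 := congrArg Matrix.det key
  rw [Matrix.det_mul, Matrix.det_mul, mul_comm] at h2
  have h3 := mul_right_cancel₀ (Matrix.det_vandermonde_ne_zero_iff.mpr ha) h2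
  rw [Algebra.norm_eq_matrix_det P.basis, ← RingHom.mapMatrix_apply, ← RingHom.map_det] at *
  rw [h3, Matrix.det_diagonal]
  rfl

end Vandermonde

end AbhyankarMoh

end

/-! ### Weierstrass polynomials, irreducibility and intersection numbers. -/

noncomputable section

open PowerSeries

namespace AbhyankarMoh

variable {K : Type*} [Field K]

section Distinguished

variable {R : Type*} [CommRing R] {I : Ideal R}

/-- Modulo the prime ideal `I` the product becomes a power of the variable, and over a domain a
monic divisor of such a power is again one. -/
theorem IsDistinguishedAt.of_mul_left [hI : I.IsPrime] {a b : Polynomial R} (ha : a.Monic)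
    (h : (a * b).IsDistinguishedAt I) : a.IsDistinguishedAt I := by
  refine { monic := ha, mem := fun {n} hn => ?_ }
  have h1 := h.map_eq_X_pow
  rw [Polynomial.map_mul] at h1
  obtain ⟨i, -, hi⟩ := (dvd_prime_pow Polynomial.prime_X _).mp (Dvd.intro _ h1)
  have h2 := Polynomial.eq_of_monic_of_associated (ha.map _) (Polynomial.monic_X_pow i) hi
  have h3 : i = a.natDegree := by
    rw [← ha.natDegree_map (Ideal.Quotient.mk I), h2, Polynomial.natDegree_X_pow]
  have h4 := congrArg (fun r => Polynomial.coeff r n) h2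
  simp only [Polynomial.coeff_map, Polynomial.coeff_X_pow, h3, hn.ne, if_false] at h4
  exact Ideal.Quotient.eq_zero_iff_mem.mp h4

theorem IsDistinguishedAt.natDegree_eq_zero (hI : I ≠ ⊤) {a : Polynomial R}
    (h : a.IsDistinguishedAt I) (hu : IsUnit (a : PowerSeries R)) : a.natDegree = 0 := by
  by_contra h0
  have h1 := h.mem (Nat.pos_of_ne_zero h0)
  refine hI (Ideal.eq_top_of_isUnit_mem _ h1 ?_)
  have := PowerSeries.isUnit_iff_constantCoeff.mp hu
  rwa [Polynomial.constantCoeff_coe] at this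

end Distinguished

theorem irreducible_expandY_iff {f : MvPowerSeries (Fin 2) K} :
    Irreducible (expandY f) ↔ Irreducible f :=
  MulEquiv.irreducible_iff (expandY (K := K)).toMulEquiv

theorem IsWeierstrassPolynomialOf.monic {p : Polynomial (PowerSeries K)}
    {f : MvPowerSeries (Fin 2) K} (h : IsWeierstrassPolynomialOf p f) : p.Monic :=
  h.choose_spec.isDistinguishedAt.monic

/-- A monic factor of a distinguished polynomial is distinguished, and a distinguished polynomial
that becomes a unit among power series has degree zero. Hence a proper factorization of `p` would
remain proper in `K[[X, Y]]`. -/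
theorem IsWeierstrassPolynomialOf.irreducible {p : Polynomial (PowerSeries K)}
    {f : MvPowerSeries (Fin 2) K} (h : IsWeierstrassPolynomialOf p f) (hf : Irreducible f) :
    Irreducible p := by
  obtain ⟨u, hd, hu, he⟩ := h
  have hI : IsLocalRing.maximalIdeal (PowerSeries K) ≠ ⊤ := Ideal.IsPrime.ne_top'
  have h1 : Irreducible (p : PowerSeries (PowerSeries K)) := by
    rw [← irreducible_expandY_iff, he, irreducible_mul_isUnit hu] at hf
    exact hf
  rw [hd.monic.irreducible_iff_natDegree]
  refine ⟨?_, ?_⟩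
  · rintro rfl
    exact h1.not_isUnit (by simp)
  · rintro a b ha hb rfl
    rw [Polynomial.coe_mul] at h1
    rcases h1.isUnit_or_isUnit rfl with h2 | h2
    · exact Or.inl (IsDistinguishedAt.natDegree_eq_zero hI (IsDistinguishedAt.of_mul_left ha hd) h2)
    · rw [mul_comm] at hd
      exact Or.inr (IsDistinguishedAt.natDegree_eq_zero hI (IsDistinguishedAt.of_mul_left hb hd) h2)

/-- Weierstrass preparation applied to both factors of `g` turns a factorization of `g` into one of
`q`, since the preparation of `g` is unique. -/
theorem IsWeierstrassPolynomialOf.irreducible_of_irreducible {q : Polynomial (PowerSeries K)}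
    {g : MvPowerSeries (Fin 2) K} (h : IsWeierstrassPolynomialOf q g) (hq : Irreducible q) :
    Irreducible g := by
  obtain ⟨u, hw⟩ := h
  have hI : IsLocalRing.maximalIdeal (PowerSeries K) ≠ ⊤ := Ideal.IsPrime.ne_top'
  rw [← irreducible_expandY_iff]
  refine ⟨fun hg => hq.not_isUnit ?_, fun a b hab => ?_⟩
  · have h1 : IsUnit (q : PowerSeries (PowerSeries K)) := by
      rw [hw.eq_mul] at hg
      exact isUnit_of_mul_isUnit_left hg
    have h2 := IsDistinguishedAt.natDegree_eq_zero hI hw.isDistinguishedAt h1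
    rw [hw.isDistinguishedAt.monic.natDegree_eq_zero.mp h2]
    exact isUnit_one
  · have h0 := PowerSeries.IsWeierstrassFactorization.map_ne_zero hw
    rw [hab, map_mul] at h0
    obtain ⟨a₁, u₁, ha⟩ := PowerSeries.exists_isWeierstrassFactorization (left_ne_zero_of_mul h0)
    obtain ⟨b₁, u₂, hb⟩ := PowerSeries.exists_isWeierstrassFactorization (right_ne_zero_of_mul h0)
    have hm := PowerSeries.IsWeierstrassFactorizationAt.mul ha hb
    rw [← hab] at hm
    obtain ⟨h1, -⟩ := PowerSeries.IsWeierstrassFactorization.elim hw hm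
    rcases hq.isUnit_or_isUnit h1 with h2 | h2
    · left
      rw [ha.eq_mul]
      exact (h2.map (Polynomial.coeToPowerSeries.ringHom (R := PowerSeries K))).mul ha.isUnit
    · right
      rw [hb.eq_mul]
      exact (h2.map (Polynomial.coeToPowerSeries.ringHom (R := PowerSeries K))).mul hb.isUnit

theorem intersectionNumber_eq (f g : MvPowerSeries (Fin 2) K) :
    intersectionNumber f g = Cardinal.toENat (Module.rank K
      (PowerSeries (PowerSeries K) ⧸ Ideal.span {expandY f, expandY g})) := by
  have h1 : Ideal.span {expandY f, expandY g} =
      (Ideal.span {f, g}).map (expandY (K := K) : _ →+* PowerSeries (PowerSeries K)) := by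
    rw [Ideal.map_span, Set.image_pair]
    rfl
  exact congrArg Cardinal.toENat
    (Ideal.quotientEquivAlg (Ideal.span {f, g}) _ expandY h1).toLinearEquiv.rank_eq

/-- The substitution `X = 0`. -/
def atXZero (K : Type*) [Field K] : PowerSeries (PowerSeries K) →ₐ[K] PowerSeries K :=
  { PowerSeries.map (PowerSeries.constantCoeff (R := K)) with
    commutes' := fun r => by
      change PowerSeries.map _ _ = _
      ext n
      rw [PowerSeries.algebraMap_apply, PowerSeries.coeff_map, PowerSeries.algebraMap_apply,
        PowerSeries.coeff_C, PowerSeries.coeff_C]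
      split_ifs <;> simp }

theorem coeff_atXZero (F : PowerSeries (PowerSeries K)) (n : ℕ) :
    PowerSeries.coeff n (atXZero K F) = PowerSeries.constantCoeff (PowerSeries.coeff n F) :=
  PowerSeries.coeff_map _ _ _

theorem atXZero_surjective : Function.Surjective (atXZero K) := by
  intro h
  refine ⟨PowerSeries.map PowerSeries.C h, ?_⟩
  ext n
  rw [coeff_atXZero, PowerSeries.coeff_map, PowerSeries.constantCoeff_C]

theorem C_X_dvd_of_atXZero_eq_zero {F : PowerSeries (PowerSeries K)} (h : atXZero K F = 0) :
    PowerSeries.C (X : PowerSeries K) ∣ F := by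
  have h1 : ∀ n, (X : PowerSeries K) ∣ PowerSeries.coeff n F := fun n => by
    rw [PowerSeries.X_dvd_iff, ← coeff_atXZero, h, map_zero]
  choose c hc using h1
  refine ⟨PowerSeries.mk c, ?_⟩
  ext1 n
  rw [PowerSeries.coeff_C_mul, PowerSeries.coeff_mk, hc]

/-- Dividing by `X` first leaves `K[[Y]] / (f(0, Y))`. -/
theorem intersectionNumber_X (f : MvPowerSeries (Fin 2) K) :
    intersectionNumber f (MvPowerSeries.X 0) = (atXZero K (expandY f)).order := by
  rw [intersectionNumber_eq, expandY_X, ← toENat_rank_quotient_span]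
  let e : PowerSeries (PowerSeries K) →ₐ[K]
      (PowerSeries K ⧸ Ideal.span {atXZero K (expandY f)}) :=
    (Ideal.Quotient.mkₐ K _).comp (atXZero K)
  have he : Function.Surjective e :=
    (Ideal.Quotient.mkₐ_surjective K _).comp atXZero_surjective
  have hk : Ideal.span {expandY f, PowerSeries.C (X : PowerSeries K)} = RingHom.ker e := by
    apply le_antisymm
    · rw [Ideal.span_le]
      rintro _ (rfl | rfl)
      · exact Ideal.Quotient.eq_zero_iff_mem.mpr (Ideal.mem_span_singleton_self _)
      · have : atXZero K (PowerSeries.C (X : PowerSeries K)) = 0 := by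
          ext n
          rw [coeff_atXZero, PowerSeries.coeff_C]
          split_ifs <;> simp
        change Ideal.Quotient.mk _ (atXZero K (PowerSeries.C (X : PowerSeries K))) = 0
        rw [this, map_zero]
    · intro F hF
      have hF' : Ideal.Quotient.mk _ (atXZero K F) = 0 := hF
      rw [Ideal.Quotient.eq_zero_iff_mem, Ideal.mem_span_singleton] at hF'
      obtain ⟨u, hu⟩ := hF'
      obtain ⟨U, rfl⟩ := atXZero_surjective u
      obtain ⟨H, hH⟩ := C_X_dvd_of_atXZero_eq_zero (F := F - expandY f * U)
        (by rw [map_sub, map_mul, hu, sub_self])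
      rw [Ideal.mem_span_pair]
      exact ⟨U, H, by rw [sub_eq_iff_eq_add] at hH; rw [hH]; ring⟩
  rw [((Ideal.quotientEquivAlgOfEq K hk).trans
    (Ideal.quotientKerAlgEquivOfSurjective he)).toLinearEquiv.rank_eq]

theorem order_map_residue (F : PowerSeries (PowerSeries K)) :
    (F.map (IsLocalRing.residue (PowerSeries K))).order = (atXZero K F).order := by
  have h : ∀ n, PowerSeries.coeff n (F.map (IsLocalRing.residue (PowerSeries K))) = 0 ↔
      PowerSeries.coeff n (atXZero K F) = 0 := fun n => by
    rw [coeff_atXZero, PowerSeries.coeff_map, IsLocalRing.residue_eq_zero_iff,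
      PowerSeries.maximalIdeal_eq_span_X, Ideal.mem_span_singleton, PowerSeries.X_dvd_iff]
  apply le_antisymm
  · exact PowerSeries.le_order _ _ fun i hi => (h i).mp (PowerSeries.coeff_of_lt_order i hi)
  · exact PowerSeries.le_order _ _ fun i hi => (h i).mpr (PowerSeries.coeff_of_lt_order i hi)

theorem exists_isWeierstrassPolynomialOf {f : MvPowerSeries (Fin 2) K}
    (hf : intersectionNumber f (MvPowerSeries.X 0) ≠ ⊤) : ∃ p, IsWeierstrassPolynomialOf p f := by
  rw [intersectionNumber_X, ← order_map_residue, ne_eq, PowerSeries.order_eq_top] at hf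
  exact PowerSeries.exists_isWeierstrassFactorization hf

theorem IsWeierstrassPolynomialOf.natDegree_eq {p : Polynomial (PowerSeries K)}
    {f : MvPowerSeries (Fin 2) K} (h : IsWeierstrassPolynomialOf p f) :
    (p.natDegree : ℕ∞) = intersectionNumber f (MvPowerSeries.X 0) := by
  obtain ⟨u, hw⟩ := h
  rw [PowerSeries.IsWeierstrassFactorization.natDegree_eq_toNat_order_map hw,
    PowerSeries.coe_toNat_order (PowerSeries.IsWeierstrassFactorization.map_ne_zero hw),
    order_map_residue, intersectionNumber_X]

/-- Weierstrass division by `f` makes `K[[X]][Y] / (p)` surject onto `K[[X, Y]] / (f, g)`, and the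
class of `q` goes to zero. The surjection alone gives the inequality, the only direction that the
theorem needs. -/
theorem intersectionNumber_le_order_norm {p q : Polynomial (PowerSeries K)}
    {f g : MvPowerSeries (Fin 2) K} (hp : IsWeierstrassPolynomialOf p f)
    (hq : IsWeierstrassPolynomialOf q g) (hirr : Irreducible p)
    (hpq : AdjoinRoot.mk p q ≠ 0) :
    intersectionNumber f g ≤
      (Algebra.norm (PowerSeries K) (AdjoinRoot.mk p q)).order := by
  have : IsDomain (AdjoinRoot p) := AdjoinRoot.isDomain_of_prime hirr.prime
  obtain ⟨u, hp⟩ := hp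
  obtain ⟨v, hq⟩ := hq
  obtain ⟨h1, h2⟩ := finrank_quotient_span_eq_order_norm (K := K)
    (AdjoinRoot.powerBasis' hp.isDistinguishedAt.monic).basis hpq
  rw [← h2, ← Cardinal.toENat_nat, Module.finrank_eq_rank, intersectionNumber_eq]
  apply Cardinal.toENat.monotone'
  set J : Ideal (PowerSeries (PowerSeries K)) := Ideal.span {expandY f, expandY g} with hJ
  have hmem : ∀ {r : Polynomial (PowerSeries K)} {F w : PowerSeries (PowerSeries K)},
      IsUnit w → F = r * w → F ∈ J → (r : PowerSeries (PowerSeries K)) ∈ J := by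
    rintro r F w hw rfl hF
    exact (Ideal.mul_unit_mem_iff_mem J hw).mp hF
  let e₀ : AdjoinRoot p →+* (PowerSeries (PowerSeries K) ⧸ J) :=
    Ideal.Quotient.lift (Ideal.span {p})
      ((Ideal.Quotient.mk J).comp (Polynomial.coeToPowerSeries.ringHom (R := PowerSeries K)))
      (fun a ha => by
        obtain ⟨c, rfl⟩ := Ideal.mem_span_singleton'.mp ha
        rw [map_mul]
        refine mul_eq_zero_of_right _ (Ideal.Quotient.eq_zero_iff_mem.mpr ?_)
        exact hmem hp.isUnit hp.eq_mul (Ideal.subset_span (by simp)))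
  let e : AdjoinRoot p →ₐ[K] (PowerSeries (PowerSeries K) ⧸ J) :=
    { e₀ with
      commutes' := fun c => by
        change Ideal.Quotient.mk J ((algebraMap K (Polynomial (PowerSeries K)) c :
          Polynomial (PowerSeries K)) : PowerSeries (PowerSeries K)) = Ideal.Quotient.mk J _
        rw [Polynomial.algebraMap_apply, Polynomial.coe_C]
        exact congrArg _ PowerSeries.algebraMap_apply.symm }
  have he : Function.Surjective e := by
    intro x
    obtain ⟨F, rfl⟩ := Ideal.Quotient.mk_surjective x
    obtain ⟨c, r, hr⟩ := PowerSeries.exists_isWeierstrassDivision F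
      (PowerSeries.IsWeierstrassFactorization.map_ne_zero hp)
    refine ⟨AdjoinRoot.mk p r, ?_⟩
    change Ideal.Quotient.mk J (r : PowerSeries (PowerSeries K)) = _
    rw [hr.eq_mul_add, map_add, map_mul,
      Ideal.Quotient.eq_zero_iff_mem.mpr (Ideal.subset_span (by simp) : expandY f ∈ J),
      zero_mul, zero_add]
  have hker : ∀ a, a ∈ Ideal.span {AdjoinRoot.mk p q} → e a = 0 := by
    intro a ha
    obtain ⟨c, rfl⟩ := Ideal.mem_span_singleton'.mp ha
    rw [map_mul]
    refine mul_eq_zero_of_right _ (Ideal.Quotient.eq_zero_iff_mem.mpr ?_)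
    exact hmem hq.isUnit hq.eq_mul (Ideal.subset_span (by simp))
  exact LinearMap.rank_le_of_surjective (Ideal.Quotient.liftₐ _ e hker).toLinearMap
    (Ideal.Quotient.lift_surjective_of_surjective _ hker he)

end AbhyankarMoh

end

/-! ### Hensel factorization and the Newton-Puiseux theorem. -/

noncomputable section

open PowerSeries

namespace AbhyankarMoh

variable {K : Type*} [Field K]

section Hensel

variable {A : Type*} [CommRing A] [IsLocalRing A]

open IsLocalRing

/-- A monic polynomial over a complete local ring whose reduction vanishes at the origin and is not
a power of the variable has a proper monic factorization. -/
theorem exists_mul_eq_of_not_isDistinguishedAt [IsAdicComplete (maximalIdeal A) A]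
    {r : Polynomial A} (hr : r.Monic) (h0 : r.coeff 0 ∈ maximalIdeal A)
    (hd : ¬ r.IsDistinguishedAt (maximalIdeal A)) :
    ∃ w v : Polynomial A, w.Monic ∧ v.Monic ∧ r = w * v ∧ w.natDegree ≠ 0 ∧ v.natDegree ≠ 0 := by
  have h1 : (r : PowerSeries A).map (residue A) ≠ 0 := by
    rw [← Polynomial.polynomial_map_coe, ne_eq, Polynomial.coe_eq_zero_iff]
    exact (hr.map _).ne_zero
  obtain ⟨w, u, hw⟩ := PowerSeries.exists_isWeierstrassFactorization h1
  have hm := hw.isDistinguishedAt.monic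
  -- Weierstrass division identifies `A[Y] / (w)` with `A[[Y]] / (w)`, so divisibility by `w`
  -- descends from power series to polynomials.
  have h2 : w ∣ r := by
    have h3 : hw.isDistinguishedAt.algEquivQuotient (Ideal.Quotient.mk _ r) = 0 := by
      change Ideal.Quotient.mk _ (r : PowerSeries A) = 0
      rw [Ideal.Quotient.eq_zero_iff_mem, hw.eq_mul]
      exact Ideal.mul_mem_right _ _ (Ideal.mem_span_singleton_self _)
    rw [EmbeddingLike.map_eq_zero_iff, Ideal.Quotient.eq_zero_iff_mem,
      Ideal.mem_span_singleton] at h3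
    exact h3
  obtain ⟨v, hv⟩ := h2
  have hvm : v.Monic := Polynomial.Monic.of_mul_monic_left hm (hv ▸ hr)
  refine ⟨w, v, hm, hvm, hv, fun hw0 => ?_, fun hv0 => hd ?_⟩
  -- If `w = 1` then `r` is a unit among power series, although its constant term is in the maximal
  -- ideal.
  · rw [hm.natDegree_eq_zero.mp hw0] at hw
    have h4 := PowerSeries.isUnit_iff_constantCoeff.mp hw.isUnit
    have h5 := hw.eq_mul
    rw [Polynomial.coe_one, one_mul] at h5
    rw [← h5, Polynomial.constantCoeff_coe] at h4
    exact h0 h4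
  · rw [hv, hvm.natDegree_eq_zero.mp hv0, mul_one]
    exact hw.isDistinguishedAt

end Hensel

theorem coeff_taylor_natDegree_sub_one {R : Type*} [CommRing R] {p : Polynomial R} (hp : p.Monic)
    (h : p.natDegree ≠ 0) (c : R) :
    (Polynomial.taylor c p).coeff (p.natDegree - 1) =
      p.coeff (p.natDegree - 1) + p.natDegree * c := by
  obtain ⟨n, hn⟩ := Nat.exists_eq_succ_of_ne_zero h
  have h1 : (Polynomial.hasseDeriv n p).natDegree < 2 := by
    have := Polynomial.natDegree_hasseDeriv_le p n
    omega
  have h2 : p.coeff (n + 1) = 1 := by rw [← Nat.succ_eq_add_one, ← hn]; exact hp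
  rw [hn, Nat.succ_sub_one, Polynomial.taylor_coeff, Polynomial.eval_eq_sum_range' h1,
    Finset.sum_range_succ, Finset.sum_range_one, Polynomial.hasseDeriv_coeff,
    Polynomial.hasseDeriv_coeff, zero_add, add_comm 1 n, h2]
  simp

/-- This divides all roots by `s`. Defining the new coefficients by the divisibility hypothesis
avoids dividing by `s`, which may be a zero divisor. -/
theorem exists_scaleRoots_eq {R : Type*} [CommRing R] {p : Polynomial R}
    (hp : p.Monic) (s : R) (h : ∀ i < p.natDegree, s ^ (p.natDegree - i) ∣ p.coeff i) :
    ∃ r : Polynomial R, r.Monic ∧ r.natDegree = p.natDegree ∧ r.scaleRoots s = p := by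
  nontriviality R
  choose! b hb using h
  set n := p.natDegree with hn
  let r : Polynomial R := Polynomial.X ^ n + ∑ i ∈ Finset.range n, Polynomial.monomial i (b i)
  have hdeg : (∑ i ∈ Finset.range n, Polynomial.monomial i (b i)).degree < n := by
    rw [Polynomial.degree_lt_iff_coeff_zero]
    intro m hm
    rw [Polynomial.finsetSum_coeff]
    refine Finset.sum_eq_zero fun i hi => Polynomial.coeff_monomial_of_ne _ ?_
    exact ((Finset.mem_range.mp hi).trans_le hm).ne'
  have hm : r.Monic := Polynomial.monic_X_pow_add hdeg
  have hd : r.natDegree = n := by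
    have : r.degree = n := by
      rw [Polynomial.degree_add_eq_left_of_degree_lt] <;> rw [Polynomial.degree_X_pow]
      exact hdeg
    exact Polynomial.natDegree_eq_of_degree_eq_some this
  refine ⟨r, hm, hd, ?_⟩
  ext i
  rw [Polynomial.coeff_scaleRoots, hd]
  rcases lt_trichotomy i n with hi | rfl | hi
  · have : r.coeff i = b i := by
      simp [r, Polynomial.coeff_monomial, Polynomial.coeff_X_pow, hi, hi.ne]
    rw [this, hb i hi, mul_comm]
  · rw [Nat.sub_self, pow_zero, mul_one]
    have h1 : r.coeff n = 1 := by rw [← hd]; exact hm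
    rw [h1, hn, hp.coeff_natDegree]
  · rw [Polynomial.coeff_eq_zero_of_natDegree_lt (hd ▸ hi), zero_mul,
      Polynomial.coeff_eq_zero_of_natDegree_lt hi]

/-- The substitution `X ↦ X ^ N` as a ring endomorphism of `K[[X]]`. -/
abbrev expandHom (K : Type*) [Field K] (N : ℕ) (hN : N ≠ 0) : PowerSeries K →+* PowerSeries K :=
  (PowerSeries.expand N hN : PowerSeries K →ₐ[K] PowerSeries K)

theorem expandHom_comp {M N : ℕ} (hM : M ≠ 0) (hN : N ≠ 0) :
    (expandHom K M hM).comp (expandHom K N hN) = expandHom K (M * N) (mul_ne_zero hM hN) :=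
  RingHom.ext fun x => (PowerSeries.expand_mul M hM N hN x).symm

theorem expandHom_injective {N : ℕ} (hN : N ≠ 0) : Function.Injective (expandHom K N hN) := by
  intro x y h
  ext n
  rw [← PowerSeries.coeff_expand_mul N hN x, ← PowerSeries.coeff_expand_mul N hN y]
  exact congrArg _ h

/-- The polynomial splits after a substitution `X ↦ X ^ N`. -/
def SplitsOverPuiseux (p : Polynomial (PowerSeries K)) : Prop :=
  ∃ (N : ℕ) (hN : N ≠ 0), (p.map (expandHom K N hN)).Splits

namespace SplitsOverPuiseux

variable {p q : Polynomial (PowerSeries K)}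

theorem of_splits (h : p.Splits) : SplitsOverPuiseux p := ⟨1, one_ne_zero, h.map _⟩

theorem mul (hp : SplitsOverPuiseux p) (hq : SplitsOverPuiseux q) :
    SplitsOverPuiseux (p * q) := by
  obtain ⟨M, hM, h⟩ := hp
  obtain ⟨N, hN, h'⟩ := hq
  refine ⟨M * N, mul_ne_zero hM hN, ?_⟩
  rw [Polynomial.map_mul]
  refine Polynomial.Splits.mul ?_ ?_
  · have : expandHom K (M * N) (mul_ne_zero hM hN) =
        (expandHom K N hN).comp (expandHom K M hM) := by
      rw [expandHom_comp]
      simp only [mul_comm]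
    rw [this, ← Polynomial.map_map]
    exact h.map _
  · rw [← expandHom_comp hM hN, ← Polynomial.map_map]
    exact h'.map _

theorem of_map {N : ℕ} (hN : N ≠ 0) (h : SplitsOverPuiseux (p.map (expandHom K N hN))) :
    SplitsOverPuiseux p := by
  obtain ⟨M, hM, h⟩ := h
  rw [Polynomial.map_map, expandHom_comp] at h
  exact ⟨_, _, h⟩

theorem taylor (h : SplitsOverPuiseux p) (c : PowerSeries K) :
    SplitsOverPuiseux (Polynomial.taylor c p) := by
  obtain ⟨N, hN, h⟩ := h
  refine ⟨N, hN, ?_⟩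
  rw [Polynomial.map_taylor]
  exact h.taylor _

theorem of_taylor {c : PowerSeries K} (h : SplitsOverPuiseux (Polynomial.taylor c p)) :
    SplitsOverPuiseux p := by
  have := h.taylor (-c)
  rwa [Polynomial.taylor_taylor, neg_add_cancel, Polynomial.taylor_zero] at this

theorem scaleRoots (hp : p.Monic) (h : SplitsOverPuiseux p) (s : PowerSeries K) :
    SplitsOverPuiseux (p.scaleRoots s) := by
  obtain ⟨N, hN, h⟩ := h
  refine ⟨N, hN, ?_⟩
  rw [Polynomial.map_scaleRoots _ _ _ (by rw [hp.leadingCoeff, map_one]; exact one_ne_zero)]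
  exact h.scaleRoots _

end SplitsOverPuiseux

theorem mem_maximalIdeal_iff {x : PowerSeries K} :
    x ∈ IsLocalRing.maximalIdeal (PowerSeries K) ↔ PowerSeries.constantCoeff x = 0 := by
  rw [PowerSeries.maximalIdeal_eq_span_X, Ideal.mem_span_singleton, PowerSeries.X_dvd_iff]

/-- The first step of the Newton-Puiseux algorithm. -/
theorem exists_expand_eq_scaleRoots {q : Polynomial (PowerSeries K)} (hq : q.Monic)
    (h0 : ∃ i < q.natDegree, q.coeff i ≠ 0) (h1 : q.coeff (q.natDegree - 1) = 0) :
    ∃ (d : ℕ) (hd : d ≠ 0) (s : PowerSeries K) (r : Polynomial (PowerSeries K)),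
      r.Monic ∧ r.natDegree = q.natDegree ∧ r.scaleRoots s = q.map (expandHom K d hd) ∧
      r.coeff (r.natDegree - 1) = 0 ∧
      ∃ i < r.natDegree, PowerSeries.constantCoeff (r.coeff i) ≠ 0 := by
  classical
  set n := q.natDegree with hn
  -- The index `j` realizes the least slope `ord (q_i) / (n - i)` of the Newton polygon. After `X ↦
  -- X ^ (n - j)` this slope becomes the integer `u`, and every root can be divided by `X ^ u`.
  obtain ⟨j, hj, hmin⟩ := Finset.exists_min_image
    ((Finset.range n).filter fun i => q.coeff i ≠ 0)
    (fun i => ((q.coeff i).order.toNat : ℚ) / ((n - i : ℕ) : ℚ))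
    (by obtain ⟨i, hi, h⟩ := h0; exact ⟨i, by simp [hi, h]⟩)
  rw [Finset.mem_filter, Finset.mem_range] at hj
  set u := (q.coeff j).order.toNat with hu
  have hd : n - j ≠ 0 := by omega
  have hX : (X : PowerSeries K) ^ u ≠ 0 := pow_ne_zero _ PowerSeries.X_ne_zero
  have hmap : (q.map (expandHom K (n - j) hd)).natDegree = n := hq.natDegree_map _
  have hord : ∀ i < n, q.coeff i ≠ 0 → u * (n - i) ≤ (n - j) * (q.coeff i).order.toNat := by
    intro i hi hi0
    have h2 := hmin i (by simp [hi, hi0])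
    rw [div_le_div_iff₀ (by exact_mod_cast Nat.pos_of_ne_zero hd)
      (by have : 0 < n - i := by omega
          exact_mod_cast this)] at h2
    have h3 : u * (n - i) ≤ (q.coeff i).order.toNat * (n - j) := by exact_mod_cast h2
    rwa [mul_comm (n - j)]
  obtain ⟨r, hr, hrn, hrs⟩ := exists_scaleRoots_eq (hq.map (expandHom K (n - j) hd)) (X ^ u) (by
    intro i hi
    rw [hmap] at hi ⊢
    rw [Polynomial.coeff_map, ← pow_mul]
    by_cases hi0 : q.coeff i = 0
    · rw [hi0, map_zero]
      exact dvd_zero _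
    · have h2 : (q.coeff i) = X ^ (q.coeff i).order.toNat * (q.coeff i).divXPowOrder :=
        (PowerSeries.X_pow_order_mul_divXPowOrder).symm
      have h3 : expandHom K (n - j) hd (q.coeff i) =
          X ^ ((n - j) * (q.coeff i).order.toNat) *
            expandHom K (n - j) hd (q.coeff i).divXPowOrder := by
        conv_lhs => rw [h2]
        rw [map_mul, map_pow]
        congr 1
        rw [pow_mul]
        congr 1
        exact PowerSeries.expand_X _ hd
      rw [h3]
      exact Dvd.dvd.mul_right (pow_dvd_pow _ (hord i hi hi0)) _)
  rw [hmap] at hrn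
  have hcoeff : ∀ i, r.coeff i * (X ^ u) ^ (n - i) = expandHom K (n - j) hd (q.coeff i) := by
    intro i
    rw [← Polynomial.coeff_map, ← hrs, Polynomial.coeff_scaleRoots, hrn]
  refine ⟨n - j, hd, X ^ u, r, hr, hrn, hrs, ?_, j, by rw [hrn]; exact hj.1, ?_⟩
  · have := hcoeff (n - 1)
    rw [h1, map_zero] at this
    rw [hrn]
    exact (mul_eq_zero.mp this).resolve_right (pow_ne_zero _ hX)
  -- At `i = j` the slope inequality is an equality, so the new coefficient is a unit.
  · have h2 := congrArg PowerSeries.order (hcoeff j)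
    have h3 : (expandHom K (n - j) hd (q.coeff j)).order = ((n - j) * u : ℕ) := by
      refine (PowerSeries.order_expand _ hd _).trans ?_
      rw [← PowerSeries.coe_toNat_order hj.2, ← hu]
      simp
    rw [h3, ← pow_mul, PowerSeries.order_mul, PowerSeries.order_X_pow, mul_comm u] at h2
    have h4 : (r.coeff j).order = 0 := by
      have h5 : (r.coeff j).order + (((n - j) * u : ℕ) : ℕ∞) = 0 + (((n - j) * u : ℕ) : ℕ∞) := by
        rw [h2, zero_add]
      exact (ENat.add_left_injective_of_ne_top (ENat.natCast_ne_top _)) h5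
    intro h5
    exact PowerSeries.order_ne_zero_iff_constCoeff_eq_zero.mpr h5 h4

variable [IsAlgClosed K] [CharZero K]

/-- A proper factorization of a monic polynomial whose second coefficient is zero and which is not
a power of the variable modulo `X`, up to a translation. -/
theorem exists_taylor_eq_mul {r : Polynomial (PowerSeries K)} (hr : r.Monic)
    (hr0 : r.natDegree ≠ 0) (h1 : r.coeff (r.natDegree - 1) = 0)
    (h2 : ∃ i < r.natDegree, PowerSeries.constantCoeff (r.coeff i) ≠ 0) :
    ∃ (c : PowerSeries K) (w v : Polynomial (PowerSeries K)), w.Monic ∧ v.Monic ∧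
      Polynomial.taylor c r = w * v ∧ w.natDegree ≠ 0 ∧ v.natDegree ≠ 0 := by
  obtain ⟨c, hc⟩ := IsAlgClosed.exists_root (r.map (PowerSeries.constantCoeff (R := K))) (by
    rw [hr.degree_map, ne_eq, Polynomial.degree_eq_natDegree hr.ne_zero]
    exact_mod_cast hr0)
  have hm : (Polynomial.taylor (PowerSeries.C c) r).Monic := by
    rw [Polynomial.Monic, Polynomial.leadingCoeff_taylor]
    exact hr
  refine ⟨PowerSeries.C c, exists_mul_eq_of_not_isDistinguishedAt hm ?_ ?_⟩
  · rw [mem_maximalIdeal_iff, Polynomial.taylor_coeff_zero]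
    have h3 := Polynomial.eval_map_apply (f := PowerSeries.constantCoeff (R := K))
      (PowerSeries.C c) (p := r)
    rw [PowerSeries.constantCoeff_C] at h3
    rw [← h3]
    exact hc
  · intro hd
    have h3 := hd.mem (n := r.natDegree - 1) (by rw [Polynomial.natDegree_taylor]; omega)
    -- If the translate were a power of the variable modulo `X`, its second coefficient `n c` would
    -- vanish. In characteristic zero this forces `c = 0`, so `r` itself would be such a power,
    -- against `h2`.
    rw [mem_maximalIdeal_iff, coeff_taylor_natDegree_sub_one hr hr0, h1, zero_add, map_mul,
      map_natCast, PowerSeries.constantCoeff_C, mul_eq_zero] at h3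
    have h4 : c = 0 := h3.resolve_left (by exact_mod_cast hr0)
    obtain ⟨i, hi, h5⟩ := h2
    rw [h4, map_zero, Polynomial.taylor_zero] at hd
    exact h5 (mem_maximalIdeal_iff.mp (hd.mem hi))

/-- The **Newton-Puiseux theorem**. -/
theorem splitsOverPuiseux {p : Polynomial (PowerSeries K)} (hp : p.Monic) :
    SplitsOverPuiseux p := by
  induction hn : p.natDegree using Nat.strong_induction_on generalizing p with
  | _ n ih =>
    by_cases hn0 : n = 0
    · exact .of_splits (.of_natDegree_le_one_of_monic (by omega) hp)
    have hp0 : p.natDegree ≠ 0 := hn ▸ hn0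
    -- The Tschirnhausen translation, which removes the term of degree `n - 1`.
    let c : PowerSeries K := PowerSeries.C (-(n : K)⁻¹) * p.coeff (n - 1)
    have hqn : (Polynomial.taylor c p).natDegree = n := by rw [Polynomial.natDegree_taylor, hn]
    have hq : (Polynomial.taylor c p).Monic := by
      rw [Polynomial.Monic, Polynomial.leadingCoeff_taylor]
      exact hp
    have hq1 : (Polynomial.taylor c p).coeff ((Polynomial.taylor c p).natDegree - 1) = 0 := by
      rw [Polynomial.natDegree_taylor, coeff_taylor_natDegree_sub_one hp hp0, hn]
      have : (n : PowerSeries K) = PowerSeries.C (n : K) := by simp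
      rw [this, ← mul_assoc, ← map_mul, mul_neg, mul_inv_cancel₀ (by exact_mod_cast hn0)]
      simp
    refine .of_taylor (c := c) ?_
    set q := Polynomial.taylor c p
    by_cases h0 : ∃ i < q.natDegree, q.coeff i ≠ 0
    · obtain ⟨d, hd, s, r, hr, hrn, hrs, hr1, hr2⟩ := exists_expand_eq_scaleRoots hq h0 hq1
      refine .of_map hd ?_
      rw [← hrs]
      refine .scaleRoots hr ?_ s
      obtain ⟨b, w, v, hw, hv, hwv, hw0, hv0⟩ := exists_taylor_eq_mul hr (by omega) hr1 hr2
      refine .of_taylor (c := b) ?_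
      have hdeg : w.natDegree + v.natDegree = n := by
        rw [← hw.natDegree_mul hv, ← hwv, Polynomial.natDegree_taylor, hrn, hqn]
      rw [hwv]
      exact (ih _ (by omega) hw rfl).mul (ih _ (by omega) hv rfl)
    · push Not at h0
      have : q = Polynomial.X ^ n := by
        ext1 i
        rw [Polynomial.coeff_X_pow]
        split_ifs with hi
        · rw [hi, ← hqn]
          exact hq
        · rcases lt_or_gt_of_ne hi with hi | hi
          · exact h0 i (hqn ▸ hi)
          · exact Polynomial.coeff_eq_zero_of_natDegree_lt (hqn ▸ hi)
      rw [this]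
      exact .of_splits (.X_pow n)

end AbhyankarMoh

end

/-! ### Puiseux series as power series in `t = X ^ (1 / N)`. -/

noncomputable section

open PowerSeries

namespace AbhyankarMoh

variable {K : Type*} [Field K]

/-- The order embedding `k ↦ k / N` of `ℕ` into `ℚ`. -/
def divEmbedding (N : ℕ) : ℕ →+ ℚ where
  toFun k := (k : ℚ) / N
  map_zero' := by simp
  map_add' a b := by push_cast; ring

theorem divEmbedding_le_iff {N : ℕ} (hN : N ≠ 0) (a b : ℕ) :
    divEmbedding N a ≤ divEmbedding N b ↔ a ≤ b := by
  have : (0 : ℚ) < N := by exact_mod_cast Nat.pos_of_ne_zero hN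
  change (a : ℚ) / N ≤ (b : ℚ) / N ↔ _
  rw [div_le_div_iff_of_pos_right this, Nat.cast_le]

theorem divEmbedding_injective {N : ℕ} (hN : N ≠ 0) : Function.Injective (divEmbedding N) :=
  fun a b h => le_antisymm ((divEmbedding_le_iff hN a b).mp h.le)
    ((divEmbedding_le_iff hN b a).mp h.ge)

/-- The embedding of `K[[t]]` into the Hahn series with `t = X ^ (1 / N)`. -/
def puiseuxHom (K : Type*) [Field K] {N : ℕ} (hN : N ≠ 0) : PowerSeries K →+* HahnSeries ℚ K :=
  (HahnSeries.embDomainRingHom (divEmbedding N) (divEmbedding_injective hN)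
    (divEmbedding_le_iff hN)).comp (RingEquiv.toRingHom HahnSeries.toPowerSeries.symm)

section puiseuxHom

variable {N : ℕ} (hN : N ≠ 0)

theorem coeff_puiseuxHom (x : PowerSeries K) (k : ℕ) :
    (puiseuxHom K hN x).coeff ((k : ℚ) / N) = PowerSeries.coeff k x :=
  HahnSeries.embDomain_coeff (f := ⟨⟨divEmbedding N, divEmbedding_injective hN⟩,
    divEmbedding_le_iff hN _ _⟩) (x := HahnSeries.toPowerSeries.symm x) (a := k)

theorem exists_of_coeff_puiseuxHom_ne_zero {x : PowerSeries K} {r : ℚ}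
    (h : (puiseuxHom K hN x).coeff r ≠ 0) :
    ∃ k : ℕ, r = (k : ℚ) / N ∧ PowerSeries.coeff k x ≠ 0 := by
  obtain ⟨k, -, hk⟩ := HahnSeries.support_embDomain_subset
    (f := ⟨⟨divEmbedding N, divEmbedding_injective hN⟩, divEmbedding_le_iff hN _ _⟩)
    (x := HahnSeries.toPowerSeries.symm x) h
  have hk' : r = (k : ℚ) / N := hk.symm
  refine ⟨k, hk', ?_⟩
  rwa [hk', coeff_puiseuxHom] at h

theorem puiseuxHom_injective : Function.Injective (puiseuxHom K hN) := by
  intro x y h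
  ext k
  rw [← coeff_puiseuxHom hN, h, coeff_puiseuxHom]

theorem isPuiseux_puiseuxHom (x : PowerSeries K) : IsPuiseux (puiseuxHom K hN x) :=
  ⟨N, Nat.pos_of_ne_zero hN, fun _ hq =>
    (exists_of_coeff_puiseuxHom_ne_zero hN hq).imp fun _ h => h.1⟩

theorem order_puiseuxHom {x : PowerSeries K} (hx : x ≠ 0) :
    (puiseuxHom K hN x).order = (x.order.toNat : ℚ) / N := by
  have hx' : puiseuxHom K hN x ≠ 0 := (map_ne_zero_iff _ (puiseuxHom_injective hN)).mpr hx
  apply le_antisymm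
  · apply HahnSeries.order_le_of_coeff_ne_zero
    rw [coeff_puiseuxHom]
    exact PowerSeries.coeff_order hx
  · obtain ⟨k, hk, hk0⟩ := exists_of_coeff_puiseuxHom_ne_zero hN
      (mt HahnSeries.coeff_order_eq_zero.mp hx')
    rw [hk]
    have : (0 : ℚ) ≤ N := by positivity
    refine div_le_div_of_nonneg_right ?_ this
    have h1 := PowerSeries.order_le k hk0
    rw [← PowerSeries.coe_toNat_order hx] at h1
    exact_mod_cast h1

theorem puiseuxHom_comp_expandHom :
    (puiseuxHom K hN).comp (expandHom K N hN) = HahnSeries.ofPowerSeries ℚ K := by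
  refine RingHom.ext fun x => ?_
  have hN' : (N : ℚ) ≠ 0 := by exact_mod_cast hN
  have h : ∀ k : ℕ, (puiseuxHom K hN (expandHom K N hN x)).coeff (k : ℚ) =
      PowerSeries.coeff k x := fun k => by
    have : (k : ℚ) = ((N * k : ℕ) : ℚ) / N := by
      push_cast
      rw [mul_div_cancel_left₀ _ hN']
    rw [this, coeff_puiseuxHom]
    exact PowerSeries.coeff_expand_mul N hN x k
  ext r
  by_cases hr : ∃ k : ℕ, r = k
  · obtain ⟨k, rfl⟩ := hr
    rw [RingHom.comp_apply, h, HahnSeries.ofPowerSeries_apply_coeff]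
  · have h1 : (HahnSeries.ofPowerSeries ℚ K x).coeff r = 0 := by
      rw [HahnSeries.ofPowerSeries_apply]
      apply HahnSeries.embDomain_of_notMem_range
      rintro ⟨k, rfl⟩
      exact hr ⟨k, rfl⟩
    rw [h1]
    by_contra h2
    obtain ⟨k, rfl, hk⟩ := exists_of_coeff_puiseuxHom_ne_zero hN h2
    have hdvd : N ∣ k := by
      by_contra h3
      exact hk (PowerSeries.coeff_expand_of_not_dvd N hN x h3)
    obtain ⟨m, rfl⟩ := hdvd
    exact hr ⟨m, by push_cast; rw [mul_div_cancel_left₀ _ hN']⟩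

/-- Once `p` splits over `K[[t]]`, a root among Hahn series annihilates a product of linear factors
in a domain, so it comes from `K[[t]]`. -/
theorem zer_eq {p : Polynomial (PowerSeries K)} (hp : p.Monic)
    (hs : (p.map (expandHom K N hN)).Splits) :
    zer p = puiseuxHom K hN '' {a | (p.map (expandHom K N hN)).IsRoot a} := by
  have hm := hp.map (expandHom K N hN)
  ext α
  have h1 : ∀ α, p.eval₂ (HahnSeries.ofPowerSeries ℚ K) α =
      (p.map (expandHom K N hN)).eval₂ (puiseuxHom K hN) α := fun α => by
    rw [Polynomial.eval₂_map, puiseuxHom_comp_expandHom]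
  constructor
  · rintro ⟨-, h⟩
    rw [h1, hs.eq_prod_roots_of_monic hm, Polynomial.eval₂_multiset_prod, Multiset.map_map,
      Multiset.prod_eq_zero_iff, Multiset.mem_map] at h
    obtain ⟨a, ha, ha0⟩ := h
    simp only [Function.comp_apply, Polynomial.eval₂_sub, Polynomial.eval₂_X,
      Polynomial.eval₂_C, sub_eq_zero] at ha0
    exact ⟨a, Polynomial.isRoot_of_mem_roots ha, ha0.symm⟩
  · rintro ⟨a, ha, rfl⟩
    refine ⟨isPuiseux_puiseuxHom hN a, ?_⟩
    rw [h1, Polynomial.eval₂_at_apply, ha.eq_zero, map_zero]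

theorem mem_contacts_iff {p : Polynomial (PowerSeries K)} (hp : p.Monic)
    (hs : (p.map (expandHom K N hN)).Splits) {r : ℚ} :
    r ∈ contacts p ↔ ∃ a b, (p.map (expandHom K N hN)).IsRoot a ∧
      (p.map (expandHom K N hN)).IsRoot b ∧ a ≠ b ∧ ((a - b).order.toNat : ℚ) / N = r := by
  rw [contacts, zer_eq hN hp hs]
  constructor
  · rintro ⟨_, ⟨a, ha, rfl⟩, _, ⟨b, hb, rfl⟩, hab, h⟩
    have hab' : a ≠ b := fun h => hab (congrArg _ h)
    rw [← map_sub, order_puiseuxHom hN (sub_ne_zero.mpr hab')] at h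
    exact ⟨a, b, ha, hb, hab', h⟩
  · rintro ⟨a, b, ha, hb, hab, h⟩
    refine ⟨_, ⟨a, ha, rfl⟩, _, ⟨b, hb, rfl⟩, (puiseuxHom_injective hN).ne hab, ?_⟩
    rw [← map_sub, order_puiseuxHom hN (sub_ne_zero.mpr hab), h]

end puiseuxHom

/-! ### Roots of unity acting on Puiseux roots, and irreducibility. -/

section Orbit

open Polynomial (nthRootsFinset)

theorem order_rescale {ζ : K} (hζ : ζ ≠ 0) (x : PowerSeries K) :
    (PowerSeries.rescale ζ x).order = x.order := by
  have h : ∀ n, PowerSeries.coeff n (PowerSeries.rescale ζ x) = 0 ↔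
      PowerSeries.coeff n x = 0 := fun n => by
    rw [PowerSeries.coeff_rescale, mul_eq_zero, or_iff_right (pow_ne_zero _ hζ)]
  apply le_antisymm
  · exact PowerSeries.le_order _ _ fun i hi => (h i).mp (PowerSeries.coeff_of_lt_order i hi)
  · exact PowerSeries.le_order _ _ fun i hi => (h i).mpr (PowerSeries.coeff_of_lt_order i hi)

variable {N : ℕ} (hN : N ≠ 0)

include hN in
theorem mem_mu_iff {ζ : K} : ζ ∈ nthRootsFinset N (1 : K) ↔ ζ ^ N = 1 :=
  Polynomial.mem_nthRootsFinset (Nat.pos_of_ne_zero hN) 1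

include hN in
theorem mu_ne_zero {ζ : K} (hζ : ζ ∈ nthRootsFinset N (1 : K)) : ζ ≠ 0 := by
  rintro rfl
  rw [mem_mu_iff hN, zero_pow hN] at hζ
  exact zero_ne_one hζ

include hN in
theorem inv_mem_mu {ζ : K} (hζ : ζ ∈ nthRootsFinset N (1 : K)) :
    ζ⁻¹ ∈ nthRootsFinset N (1 : K) := by
  rw [mem_mu_iff hN] at *
  rw [inv_pow, hζ, inv_one]

include hN in
theorem mul_mem_mu {ζ τ : K} (hζ : ζ ∈ nthRootsFinset N (1 : K))
    (hτ : τ ∈ nthRootsFinset N (1 : K)) : ζ * τ ∈ nthRootsFinset N (1 : K) := by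
  rw [mem_mu_iff hN] at *
  rw [mul_pow, hζ, hτ, one_mul]

theorem rescale_inv_rescale {ζ : K} (hζ : ζ ≠ 0) (x : PowerSeries K) :
    PowerSeries.rescale ζ⁻¹ (PowerSeries.rescale ζ x) = x := by
  rw [PowerSeries.rescale_rescale, mul_inv_cancel₀ hζ, PowerSeries.rescale_one, RingHom.id_apply]

theorem rescale_expandHom {ζ : K} (hζ : ζ ∈ nthRootsFinset N (1 : K)) (x : PowerSeries K) :
    PowerSeries.rescale ζ (expandHom K N hN x) = expandHom K N hN x := by
  rw [mem_mu_iff hN] at hζ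
  ext m
  rw [PowerSeries.coeff_rescale]
  by_cases h : N ∣ m
  · obtain ⟨k, rfl⟩ := h
    rw [pow_mul, hζ, one_pow, one_mul]
  · have : PowerSeries.coeff m (expandHom K N hN x) = 0 :=
      PowerSeries.coeff_expand_of_not_dvd N hN x h
    rw [this, mul_zero]

theorem rescale_isRoot {p : Polynomial (PowerSeries K)} {ζ : K}
    (hζ : ζ ∈ nthRootsFinset N (1 : K)) {a : PowerSeries K}
    (ha : (p.map (expandHom K N hN)).IsRoot a) :
    (p.map (expandHom K N hN)).IsRoot (PowerSeries.rescale ζ a) := by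
  have h1 : (p.map (expandHom K N hN)).map (PowerSeries.rescale ζ) = p.map (expandHom K N hN) := by
    rw [Polynomial.map_map]
    congr 1
    exact RingHom.ext fun x => rescale_expandHom hN hζ x
  have h2 := ha.map (f := PowerSeries.rescale ζ)
  rwa [h1] at h2

open Classical in
/-- The orbit of `a(t)` under the substitutions `t ↦ ζ t`, where `ζ ^ N = 1`. -/
def conjugates (N : ℕ) (a : PowerSeries K) : Finset (PowerSeries K) :=
  (nthRootsFinset N (1 : K)).image fun ζ => PowerSeries.rescale ζ a

theorem mem_conjugates {a b : PowerSeries K} :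
    b ∈ conjugates N a ↔ ∃ ζ ∈ nthRootsFinset N (1 : K), PowerSeries.rescale ζ a = b := by
  simp [conjugates]

include hN in
theorem self_mem_conjugates (a : PowerSeries K) : a ∈ conjugates N a :=
  mem_conjugates.mpr ⟨1, (mem_mu_iff hN).mpr (one_pow N), by
    rw [PowerSeries.rescale_one, RingHom.id_apply]⟩

include hN in
theorem rescale_mem_conjugates {a b : PowerSeries K} {ζ : K}
    (hζ : ζ ∈ nthRootsFinset N (1 : K)) (hb : b ∈ conjugates N a) :
    PowerSeries.rescale ζ b ∈ conjugates N a := by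
  obtain ⟨τ, hτ, rfl⟩ := mem_conjugates.mp hb
  exact mem_conjugates.mpr ⟨τ * ζ, mul_mem_mu hN hτ hζ, (PowerSeries.rescale_rescale _ _ _).symm⟩

include hN in
theorem conjugates_eq_of_mem {a b : PowerSeries K} (hb : b ∈ conjugates N a) :
    conjugates N b = conjugates N a := by
  apply le_antisymm
  · intro x hx
    obtain ⟨τ, hτ, rfl⟩ := mem_conjugates.mp hx
    exact rescale_mem_conjugates hN hτ hb
  · obtain ⟨ζ, hζ, rfl⟩ := mem_conjugates.mp hb
    intro x hx
    obtain ⟨τ, hτ, rfl⟩ := mem_conjugates.mp hx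
    refine mem_conjugates.mpr ⟨ζ⁻¹ * τ, mul_mem_mu hN (inv_mem_mu hN hζ) hτ, ?_⟩
    rw [← PowerSeries.rescale_rescale, rescale_inv_rescale (mu_ne_zero hN hζ)]

/-- The monic polynomial whose roots are the conjugates of `a`. -/
def orbitPoly (N : ℕ) (a : PowerSeries K) : Polynomial (PowerSeries K) :=
  ∏ b ∈ conjugates N a, (Polynomial.X - Polynomial.C b)

theorem orbitPoly_monic (a : PowerSeries K) : (orbitPoly N a).Monic :=
  Polynomial.monic_prod_of_monic _ _ fun b _ => Polynomial.monic_X_sub_C b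

theorem natDegree_orbitPoly (a : PowerSeries K) :
    (orbitPoly N a).natDegree = (conjugates N a).card :=
  Polynomial.natDegree_finsetProd_X_sub_C_eq_card _ _

theorem splits_orbitPoly (a : PowerSeries K) : (orbitPoly N a).Splits :=
  Polynomial.Splits.prod fun b _ => Polynomial.Splits.X_sub_C b

theorem isRoot_orbitPoly {a x : PowerSeries K} :
    (orbitPoly N a).IsRoot x ↔ x ∈ conjugates N a := by
  rw [Polynomial.IsRoot, orbitPoly, Polynomial.eval_prod, Finset.prod_eq_zero_iff]
  simp [sub_eq_zero]

include hN in
theorem map_rescale_orbitPoly {ζ : K} (hζ : ζ ∈ nthRootsFinset N (1 : K)) (a : PowerSeries K) :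
    (orbitPoly N a).map (PowerSeries.rescale ζ) = orbitPoly N a := by
  have h0 := mu_ne_zero hN hζ
  rw [orbitPoly, Polynomial.map_prod]
  refine Finset.prod_bij' (fun b _ => PowerSeries.rescale ζ b)
    (fun b _ => PowerSeries.rescale ζ⁻¹ b) (fun b hb => rescale_mem_conjugates hN hζ hb)
    (fun b hb => rescale_mem_conjugates hN (inv_mem_mu hN hζ) hb)
    (fun b _ => rescale_inv_rescale h0 b) (fun b _ => ?_) (fun b _ => by simp)
  have := rescale_inv_rescale (inv_ne_zero h0) b
  rwa [inv_inv] at this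

/-- The roots of `q` in `K[[t]]` are stable under the action, so all the distinct conjugates of `a`
are among them. Divisibility then descends to `K[[X]]` because `p` is monic. -/
theorem dvd_of_isRoot {p q : Polynomial (PowerSeries K)} {a : PowerSeries K} (hp : p.Monic)
    (hpa : p.map (expandHom K N hN) = orbitPoly N a)
    (hq : (q.map (expandHom K N hN)).IsRoot a) : p ∣ q := by
  by_cases hq0 : q = 0
  · rw [hq0]
    exact dvd_zero _
  rw [← Polynomial.map_dvd_map _ (expandHom_injective hN) hp, hpa, orbitPoly]
  have h0 : q.map (expandHom K N hN) ≠ 0 :=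
    (Polynomial.map_ne_zero_iff (expandHom_injective hN)).mpr hq0
  refine (Multiset.prod_X_sub_C_dvd_iff_le_roots h0 (conjugates N a).val).mpr ?_
  rw [Multiset.le_iff_subset (conjugates N a).nodup]
  intro b hb
  obtain ⟨ζ, hζ, rfl⟩ := mem_conjugates.mp hb
  exact (Polynomial.mem_roots h0).mpr (rescale_isRoot hN hζ hq)

/-- Rescaling preserves orders, so one root of each pair can be moved to `a`. -/
theorem mem_contacts_iff_of_map_eq_orbitPoly {p : Polynomial (PowerSeries K)} {a : PowerSeries K}
    (hp : p.Monic) (hpa : p.map (expandHom K N hN) = orbitPoly N a) {r : ℚ} :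
    r ∈ contacts p ↔ ∃ ζ ∈ nthRootsFinset N (1 : K), PowerSeries.rescale ζ a ≠ a ∧
      ((PowerSeries.rescale ζ a - a).order.toNat : ℚ) / N = r := by
  rw [mem_contacts_iff hN hp (hpa ▸ splits_orbitPoly a), hpa]
  simp only [isRoot_orbitPoly]
  constructor
  · rintro ⟨x, y, hx, hy, hxy, h⟩
    obtain ⟨ζ, hζ, rfl⟩ := mem_conjugates.mp hx
    obtain ⟨τ, hτ, rfl⟩ := mem_conjugates.mp hy
    have h0 := mu_ne_zero hN hτ
    have h1 : PowerSeries.rescale τ (PowerSeries.rescale (ζ * τ⁻¹) a) =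
        PowerSeries.rescale ζ a := by
      rw [PowerSeries.rescale_rescale, mul_assoc, inv_mul_cancel₀ h0, mul_one]
    refine ⟨ζ * τ⁻¹, mul_mem_mu hN hζ (inv_mem_mu hN hτ), fun h2 => hxy ?_, ?_⟩
    · rw [← h1, h2]
    · rw [← h, ← h1, ← map_sub, order_rescale h0]
  · rintro ⟨ζ, hζ, hne, h⟩
    exact ⟨_, a, rescale_mem_conjugates hN hζ (self_mem_conjugates hN a),
      self_mem_conjugates hN a, hne, h⟩

open Classical in
include hN in
/-- The sum of a function over the conjugates, counted with the order of the stabilizer. -/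
theorem sum_mu_eq_card_mul_sum_conjugates (a : PowerSeries K) (F : PowerSeries K → ℕ) :
    ∑ ζ ∈ nthRootsFinset N (1 : K), F (PowerSeries.rescale ζ a) =
      ((nthRootsFinset N (1 : K)).filter fun ζ => PowerSeries.rescale ζ a = a).card *
        ∑ b ∈ conjugates N a, F b := by
  rw [Finset.sum_comp F (fun ζ => PowerSeries.rescale ζ a), Finset.mul_sum]
  have himage : (nthRootsFinset N (1 : K)).image (fun ζ => PowerSeries.rescale ζ a) =
      conjugates N a := by
    ext b
    rw [mem_conjugates, Finset.mem_image]
  rw [himage]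
  refine Finset.sum_congr rfl fun b hb => ?_
  rw [smul_eq_mul]
  congr 1
  obtain ⟨τ, hτ, rfl⟩ := mem_conjugates.mp hb
  have h0 := mu_ne_zero hN hτ
  -- The fibre over the conjugate given by `τ` is the coset of the stabilizer through `τ`.
  refine Finset.card_bij' (fun ζ _ => ζ * τ⁻¹) (fun ζ _ => ζ * τ) ?_ ?_ ?_ ?_
  · intro ζ hζ
    rw [Finset.mem_filter] at hζ ⊢
    refine ⟨mul_mem_mu hN hζ.1 (inv_mem_mu hN hτ), ?_⟩
    rw [← PowerSeries.rescale_rescale, hζ.2, rescale_inv_rescale h0]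
  · intro ζ hζ
    rw [Finset.mem_filter] at hζ ⊢
    refine ⟨mul_mem_mu hN hζ.1 hτ, ?_⟩
    rw [← PowerSeries.rescale_rescale, hζ.2]
  · intro ζ _
    rw [mul_assoc, inv_mul_cancel₀ h0, mul_one]
  · intro ζ _
    rw [mul_assoc, mul_inv_cancel₀ h0, mul_one]

/-- In a monic factorization, the factor having the root `a` is divisible by `p`, so the other one
has degree zero. -/
theorem irreducible_of_map_eq_orbitPoly {p : Polynomial (PowerSeries K)} {a : PowerSeries K}
    (hp : p.Monic) (hpa : p.map (expandHom K N hN) = orbitPoly N a) : Irreducible p := by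
  have hroot : (p.map (expandHom K N hN)).IsRoot a := by
    rw [hpa, isRoot_orbitPoly]
    exact self_mem_conjugates hN a
  have key : ∀ u v : Polynomial (PowerSeries K), u.Monic → v.Monic → u * v = p →
      (u.map (expandHom K N hN)).IsRoot a → v.natDegree = 0 := by
    intro u v hu hv huv hua
    have h1 := Polynomial.natDegree_le_of_dvd (dvd_of_isRoot hN hp hpa hua) hu.ne_zero
    rw [← huv, hu.natDegree_mul hv] at h1
    omega
  rw [hp.irreducible_iff_natDegree]
  refine ⟨?_, fun u v hu hv huv => ?_⟩
  · rintro rfl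
    rw [Polynomial.map_one, Polynomial.IsRoot, Polynomial.eval_one] at hroot
    exact one_ne_zero hroot
  · have h1 := hroot
    rw [← huv, Polynomial.map_mul, Polynomial.root_mul] at h1
    rcases h1 with h1 | h1
    · exact Or.inr (key u v hu hv huv h1)
    · exact Or.inl (key v u hv hu (by rw [mul_comm, huv]) h1)

variable [IsAlgClosed K] [CharZero K]

include hN in
theorem exists_isPrimitiveRoot : ∃ ω : K, IsPrimitiveRoot ω N := by
  have : NeZero N := ⟨hN⟩
  exact HasEnoughRootsOfUnity.exists_primitiveRoot K N

include hN in
theorem card_mu : (nthRootsFinset N (1 : K)).card = N :=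
  (exists_isPrimitiveRoot hN).choose_spec.card_nthRootsFinset

/-- Invariance under a primitive root `ω` kills each coefficient whose exponent `m` has `ω ^ m ≠ 1`,
that is, is not a multiple of `N`. -/
theorem exists_expandHom_eq {x : PowerSeries K}
    (hx : ∀ ζ ∈ nthRootsFinset N (1 : K), PowerSeries.rescale ζ x = x) :
    ∃ y, expandHom K N hN y = x := by
  obtain ⟨ω, hω⟩ := exists_isPrimitiveRoot (K := K) hN
  refine ⟨PowerSeries.mk fun k => PowerSeries.coeff (N * k) x, ?_⟩
  ext m
  refine (PowerSeries.coeff_expand N hN _).trans ?_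
  split_ifs with h
  · rw [PowerSeries.coeff_mk, Nat.mul_div_cancel' h]
  · have h1 := congrArg (PowerSeries.coeff m) (hx ω ((mem_mu_iff hN).mpr hω.pow_eq_one))
    rw [PowerSeries.coeff_rescale] at h1
    have h2 : (ω ^ m - 1) * PowerSeries.coeff m x = 0 := by rw [sub_mul, h1]; ring
    refine ((mul_eq_zero.mp h2).resolve_left fun h3 => h ?_).symm
    exact hω.dvd_of_pow_eq_one m (sub_eq_zero.mp h3)

theorem exists_map_eq_orbitPoly (a : PowerSeries K) :
    ∃ p : Polynomial (PowerSeries K), p.Monic ∧ p.map (expandHom K N hN) = orbitPoly N a := by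
  have h1 : orbitPoly N a ∈ Polynomial.lifts (expandHom K N hN) := by
    rw [Polynomial.lifts_iff_coeff_lifts]
    refine fun n => exists_expandHom_eq hN fun ζ hζ => ?_
    rw [← Polynomial.coeff_map, map_rescale_orbitPoly hN hζ]
  obtain ⟨p, hp, -, hm⟩ := Polynomial.lifts_and_natDegree_eq_and_monic h1 (orbitPoly_monic a)
  exact ⟨p, hm, hp⟩

theorem map_eq_orbitPoly_of_irreducible {p : Polynomial (PowerSeries K)} {a : PowerSeries K}
    (hp : p.Monic) (hirr : Irreducible p) (ha : (p.map (expandHom K N hN)).IsRoot a) :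
    p.map (expandHom K N hN) = orbitPoly N a := by
  obtain ⟨r, hr, hra⟩ := exists_map_eq_orbitPoly hN a
  have h1 := dvd_of_isRoot hN hr hra ha
  have h2 := (irreducible_of_map_eq_orbitPoly hN hr hra).associated_of_dvd hirr h1
  rw [← Polynomial.eq_of_monic_of_associated hr hp h2, hra]

theorem map_eq_orbitPoly_of_natDegree_le {p : Polynomial (PowerSeries K)} {a : PowerSeries K}
    (hp : p.Monic) (ha : (p.map (expandHom K N hN)).IsRoot a)
    (hdeg : p.natDegree ≤ (conjugates N a).card) : p.map (expandHom K N hN) = orbitPoly N a := by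
  obtain ⟨r, hr, hra⟩ := exists_map_eq_orbitPoly hN a
  have h1 := dvd_of_isRoot hN hr hra ha
  have h2 : r.natDegree = (conjugates N a).card := by
    rw [← natDegree_orbitPoly, ← hra, hr.natDegree_map]
  rw [Polynomial.eq_of_monic_of_dvd_of_natDegree_le hr hp h1 (h2 ▸ hdeg), hra]

end Orbit

end AbhyankarMoh

end

/-! ### The lattices `M_j` and the indices `e_j` through greatest common divisors. -/

noncomputable section

open PowerSeries

namespace AbhyankarMoh

section Lattice

/-- The greatest common divisors `gcd(N, H_1, …, H_j)`. -/
def gcdSeq (N : ℕ) (H : ℕ → ℕ) : ℕ → ℕ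
  | 0 => N
  | j + 1 => Nat.gcd (gcdSeq N H j) (H (j + 1))

variable {N : ℕ} {H : ℕ → ℕ}

theorem gcdSeq_succ_dvd (j : ℕ) : gcdSeq N H (j + 1) ∣ gcdSeq N H j := Nat.gcd_dvd_left _ _

theorem gcdSeq_ne_zero (hN : N ≠ 0) (j : ℕ) : gcdSeq N H j ≠ 0 := by
  induction j with
  | zero => exact hN
  | succ j ih => exact fun h => ih (Nat.eq_zero_of_gcd_eq_zero_left h)

theorem gcdSeq_dvd_of_le {i j : ℕ} (hij : i ≤ j) : gcdSeq N H j ∣ gcdSeq N H i := by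
  induction j, hij using Nat.le_induction with
  | base => exact dvd_rfl
  | succ j _ ih => exact (gcdSeq_succ_dvd j).trans ih

theorem gcdSeq_dvd_left (j : ℕ) : gcdSeq N H j ∣ N := gcdSeq_dvd_of_le (Nat.zero_le j)

theorem gcdSeq_dvd {i j : ℕ} (hi : 1 ≤ i) (hij : i ≤ j) : gcdSeq N H j ∣ H i := by
  obtain ⟨i, rfl⟩ := Nat.exists_eq_add_of_le' hi
  exact (gcdSeq_dvd_of_le hij).trans (Nat.gcd_dvd_right _ _)

theorem pow_gcdSeq_eq_one_iff {M : Type*} [Monoid M] {x : M} (j : ℕ) :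
    x ^ gcdSeq N H j = 1 ↔ x ^ N = 1 ∧ ∀ i, 1 ≤ i → i ≤ j → x ^ H i = 1 := by
  constructor
  · intro h
    have key : ∀ k, gcdSeq N H j ∣ k → x ^ k = 1 := by
      rintro k ⟨m, rfl⟩
      rw [pow_mul, h, one_pow]
    exact ⟨key _ (gcdSeq_dvd_left j), fun i hi hij => key _ (gcdSeq_dvd hi hij)⟩
  · rintro ⟨h0, h⟩
    induction j with
    | zero => exact h0
    | succ j ih =>
      have h1 := ih fun i hi hij => h i hi (by omega)
      have h2 := h (j + 1) (by omega) le_rfl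
      rw [← orderOf_dvd_iff_pow_eq_one] at *
      exact Nat.dvd_gcd h1 h2

variable {s : ℕ} {h : Fin s → ℚ}

theorem lattice_succ (j : ℕ) :
    lattice h (j + 1) = lattice h j ⊔ AddSubgroup.zmultiples (term h (j + 1)) := by
  have : Set.Icc 1 (j + 1) = insert (j + 1) (Set.Icc 1 j) := by
    ext i
    simp only [Set.mem_Icc, Set.mem_insert_iff]
    omega
  rw [lattice, lattice, this, Set.image_insert_eq, Set.insert_comm, Set.insert_eq (term h (j + 1)),
    AddSubgroup.closure_union, sup_comm, AddSubgroup.zmultiples_eq_closure]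

/-- The embedding `m ↦ m / N` of `ℤ` into `ℚ`. -/
def intDivHom (N : ℕ) : ℤ →+ ℚ where
  toFun m := (m : ℚ) / N
  map_zero' := by simp
  map_add' a b := by push_cast; ring

theorem intDivHom_injective (hN : N ≠ 0) : Function.Injective (intDivHom N) := by
  intro a b hab
  have h1 : (a : ℚ) / N = (b : ℚ) / N := hab
  have h2 : (N : ℚ) ≠ 0 := by exact_mod_cast hN
  rw [div_left_inj' h2] at h1
  exact_mod_cast h1

/-- With `h_i = H_i / N`, the group `N M_j` is generated by `N, H_1, …, H_j`, hence by their
greatest common divisor. -/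
theorem lattice_eq_map (hN : N ≠ 0)
    (hH : ∀ j, 1 ≤ j → j ≤ s → term h j = (H j : ℚ) / N) {j : ℕ} (hj : j ≤ s) :
    lattice h j = (AddSubgroup.zmultiples (gcdSeq N H j : ℤ)).map (intDivHom N) := by
  have h0 : (N : ℚ) ≠ 0 := by exact_mod_cast hN
  induction j with
  | zero =>
    rw [AddMonoidHom.map_zmultiples, lattice]
    have : intDivHom N (gcdSeq N H 0 : ℤ) = 1 := by
      change ((N : ℤ) : ℚ) / N = 1
      rw [Int.cast_natCast, div_self h0]
    rw [this]
    simp [AddSubgroup.zmultiples_eq_closure]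
  | succ j ih =>
    have h1 : intDivHom N (H (j + 1) : ℤ) = term h (j + 1) := by
      rw [hH _ (by omega) hj]
      change ((H (j + 1) : ℤ) : ℚ) / N = _
      rw [Int.cast_natCast]
    rw [lattice_succ, ih (by omega), ← h1, ← AddMonoidHom.map_zmultiples, ← AddSubgroup.map_sup,
      Int.zmultiples_sup]
    rfl

theorem latticeIndex_mul_gcdSeq (hN : N ≠ 0)
    (hH : ∀ j, 1 ≤ j → j ≤ s → term h j = (H j : ℚ) / N) {j : ℕ} (hj : j + 1 ≤ s) :
    latticeIndex h (j + 1) * gcdSeq N H (j + 1) = gcdSeq N H j := by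
  rw [latticeIndex, Nat.add_sub_cancel, lattice_eq_map hN hH hj, lattice_eq_map hN hH (by omega),
    AddSubgroup.relIndex_map_map_of_injective _ _ (intDivHom_injective hN)]
  have h1 : AddSubgroup.zmultiples (gcdSeq N H j : ℤ) ≤
      AddSubgroup.zmultiples (gcdSeq N H (j + 1) : ℤ) := by
    rw [AddSubgroup.zmultiples_le, Int.mem_zmultiples_iff]
    exact_mod_cast gcdSeq_succ_dvd j
  have h2 := AddSubgroup.relIndex_mul_index h1
  rwa [Int.index_zmultiples, Int.index_zmultiples, Int.natAbs_natCast, Int.natAbs_natCast] at h2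

/-- The product of the indices telescopes. The factor `gcdSeq N H s` stays because `N` need not be
the least denominator of the exponents; it will turn out to be the order of the stabilizer. -/
theorem indexProd_mul_gcdSeq (hN : N ≠ 0)
    (hH : ∀ j, 1 ≤ j → j ≤ s → term h j = (H j : ℚ) / N) {j : ℕ} (hj : j ≤ s) :
    indexProd h j * gcdSeq N H s = gcdSeq N H j := by
  induction hj using Nat.decreasingInduction with
  | self => simp [indexProd]
  | of_succ j hj ih =>
    have h1 : indexProd h j = latticeIndex h (j + 1) * indexProd h (j + 1) := by
      rw [indexProd, indexProd, ← Finset.insert_Icc_succ_left_eq_Icc (by omega : j + 1 ≤ s),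
        Finset.prod_insert (by simp)]
      rfl
    rw [h1, mul_assoc, ih, latticeIndex_mul_gcdSeq hN hH (by omega)]

end Lattice

open Polynomial (nthRootsFinset)

variable {K : Type*} [Field K] {N : ℕ} (hN : N ≠ 0) {H : ℕ → ℕ} {s : ℕ} {a : PowerSeries K}

/-! ### Counting the conjugates at a given contact. -/

section Contact

theorem coeff_rescale_sub (ζ : K) (m : ℕ) :
    PowerSeries.coeff m (PowerSeries.rescale ζ a - a) = (ζ ^ m - 1) * PowerSeries.coeff m a := by
  rw [map_sub, PowerSeries.coeff_rescale, sub_mul, one_mul]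

theorem coeff_order_rescale_sub {ζ : K} (hζ : PowerSeries.rescale ζ a ≠ a) :
    ζ ^ (PowerSeries.rescale ζ a - a).order.toNat ≠ 1 ∧
      PowerSeries.coeff (PowerSeries.rescale ζ a - a).order.toNat a ≠ 0 := by
  have h1 := PowerSeries.coeff_order (sub_ne_zero.mpr hζ)
  rw [coeff_rescale_sub] at h1
  exact ⟨sub_ne_zero.mp (left_ne_zero_of_mul h1), right_ne_zero_of_mul h1⟩

theorem pow_eq_one_of_lt_order {ζ : K} {m : ℕ} (hm : PowerSeries.coeff m a ≠ 0)
    (h : PowerSeries.coeff m (PowerSeries.rescale ζ a - a) = 0) : ζ ^ m = 1 := by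
  rw [coeff_rescale_sub, mul_eq_zero, or_iff_left hm] at h
  exact sub_eq_zero.mp h

variable (hcoeff : ∀ j, 1 ≤ j → j ≤ s → PowerSeries.coeff (H j) a ≠ 0)
  (hmono : ∀ i j, 1 ≤ i → i < j → j ≤ s → H i < H j)
  (horder : ∀ ζ ∈ nthRootsFinset N (1 : K), PowerSeries.rescale ζ a ≠ a →
    ∃ j, 1 ≤ j ∧ j ≤ s ∧ (PowerSeries.rescale ζ a - a).order.toNat = H j)

-- The coefficient of `t ^ m` in `ζ a - a` is `(ζ ^ m - 1) a_m`. The order is one of the `H_j`,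
-- hence the first `H_j` with `ζ ^ H_j ≠ 1`; a condition on `ζ ^ H_1, …, ζ ^ H_l` is one on `ζ ^
-- gcdSeq N H l`.
include hN hcoeff hmono horder in
theorem order_eq_iff {ζ : K} (hζ : ζ ∈ nthRootsFinset N (1 : K)) {l : ℕ} (hl : l + 1 ≤ s) :
    (PowerSeries.rescale ζ a ≠ a ∧ (PowerSeries.rescale ζ a - a).order.toNat = H (l + 1)) ↔
      ζ ^ gcdSeq N H l = 1 ∧ ζ ^ gcdSeq N H (l + 1) ≠ 1 := by
  have hζ' := (mem_mu_iff hN).mp hζ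
  constructor
  · rintro ⟨hne, hord⟩
    obtain ⟨h1, -⟩ := coeff_order_rescale_sub hne
    rw [hord] at h1
    refine ⟨(pow_gcdSeq_eq_one_iff l).mpr ⟨hζ', fun i hi hil => ?_⟩, fun h2 => ?_⟩
    · refine pow_eq_one_of_lt_order (hcoeff i hi (by omega))
        (PowerSeries.coeff_of_lt_order_toNat _ ?_)
      rw [hord]
      exact hmono i (l + 1) hi (by omega) hl
    · exact h1 (((pow_gcdSeq_eq_one_iff _).mp h2).2 _ (by omega) le_rfl)
  · rintro ⟨h1, h2⟩
    have h3 := ((pow_gcdSeq_eq_one_iff l).mp h1).2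
    have h4 : ζ ^ H (l + 1) ≠ 1 := fun h4 => h2 ((pow_gcdSeq_eq_one_iff _).mpr
      ⟨hζ', fun i hi hil => by
        rcases Nat.lt_or_ge l i with hi' | hi'
        · rwa [show i = l + 1 by omega]
        · exact h3 i hi hi'⟩)
    have h5 : PowerSeries.coeff (H (l + 1)) (PowerSeries.rescale ζ a - a) ≠ 0 := by
      rw [coeff_rescale_sub]
      exact mul_ne_zero (sub_ne_zero.mpr h4) (hcoeff _ (by omega) hl)
    have hne : PowerSeries.rescale ζ a ≠ a := fun h6 => h5 (by rw [h6, sub_self, map_zero])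
    refine ⟨hne, ?_⟩
    obtain ⟨j, hj1, hjs, hj⟩ := horder ζ hζ hne
    obtain ⟨h6, -⟩ := coeff_order_rescale_sub hne
    have h7 := PowerSeries.order_le _ h5
    rw [← PowerSeries.coe_toNat_order (sub_ne_zero.mpr hne), Nat.cast_le] at h7
    rw [hj] at h6 h7 ⊢
    rcases lt_trichotomy j (l + 1) with h8 | h8 | h8
    · exact absurd (h3 j hj1 (by omega)) h6
    · rw [h8]
    · have := hmono (l + 1) j (by omega) h8 hjs
      omega

include hN hcoeff horder in
theorem rescale_eq_self_iff {ζ : K} (hζ : ζ ∈ nthRootsFinset N (1 : K)) :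
    PowerSeries.rescale ζ a = a ↔ ζ ^ gcdSeq N H s = 1 := by
  rw [pow_gcdSeq_eq_one_iff]
  constructor
  · intro h
    refine ⟨(mem_mu_iff hN).mp hζ, fun i hi his => ?_⟩
    exact pow_eq_one_of_lt_order (hcoeff i hi his) (by rw [h, sub_self, map_zero])
  · rintro ⟨-, h⟩
    by_contra hne
    obtain ⟨j, hj1, hjs, hj⟩ := horder ζ hζ hne
    have h6 := (coeff_order_rescale_sub hne).1
    rw [hj] at h6
    exact h6 (h j hj1 hjs)

include hN in
open Classical in
theorem filter_pow_eq {c : ℕ} (hc : c ∣ N) :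
    (nthRootsFinset N (1 : K)).filter (fun ζ => ζ ^ c = 1) = nthRootsFinset c (1 : K) := by
  have hc0 : c ≠ 0 := ne_zero_of_dvd_ne_zero hN hc
  ext ζ
  rw [Finset.mem_filter, mem_mu_iff hN, mem_mu_iff hc0, and_iff_right_iff_imp]
  intro h
  obtain ⟨m, rfl⟩ := hc
  rw [pow_mul, h, one_pow]

variable [IsAlgClosed K] [CharZero K]

include hN hcoeff horder in
open Classical in
theorem card_stabilizer :
    ((nthRootsFinset N (1 : K)).filter fun ζ => PowerSeries.rescale ζ a = a).card =
      gcdSeq N H s := by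
  have : (nthRootsFinset N (1 : K)).filter (fun ζ => PowerSeries.rescale ζ a = a) =
      (nthRootsFinset N (1 : K)).filter (fun ζ => ζ ^ gcdSeq N H s = 1) :=
    Finset.filter_congr fun ζ hζ => rescale_eq_self_iff hN hcoeff horder hζ
  rw [this, filter_pow_eq hN (gcdSeq_dvd_left s), card_mu (gcdSeq_ne_zero hN s)]

include hN hcoeff hmono horder in
open Classical in
theorem card_order_eq {l : ℕ} (hl : l + 1 ≤ s) :
    ((nthRootsFinset N (1 : K)).filter fun ζ => PowerSeries.rescale ζ a ≠ a ∧
      (PowerSeries.rescale ζ a - a).order.toNat = H (l + 1)).card + gcdSeq N H (l + 1) =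
        gcdSeq N H l := by
  have h1 : (nthRootsFinset N (1 : K)).filter (fun ζ => PowerSeries.rescale ζ a ≠ a ∧
      (PowerSeries.rescale ζ a - a).order.toNat = H (l + 1)) =
      nthRootsFinset (gcdSeq N H l) (1 : K) \ nthRootsFinset (gcdSeq N H (l + 1)) (1 : K) := by
    rw [Finset.filter_congr fun ζ hζ => order_eq_iff hN hcoeff hmono horder hζ hl,
      ← filter_pow_eq hN (gcdSeq_dvd_left l), ← filter_pow_eq hN (gcdSeq_dvd_left (l + 1))]
    ext ζ
    simp only [Finset.mem_filter, Finset.mem_sdiff]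
    tauto
  have h2 : nthRootsFinset (gcdSeq N H (l + 1)) (1 : K) ⊆ nthRootsFinset (gcdSeq N H l) (1 : K) := by
    intro ζ hζ
    rw [mem_mu_iff (gcdSeq_ne_zero hN _)] at *
    obtain ⟨m, hm⟩ := gcdSeq_succ_dvd (N := N) (H := H) l
    rw [hm, pow_mul, hζ, one_pow]
  have h3 := Finset.card_sdiff_add_card_eq_card h2
  rwa [card_mu (gcdSeq_ne_zero hN _), card_mu (gcdSeq_ne_zero hN _), ← h1] at h3

include hN hcoeff hmono horder in
theorem sum_order_eq :
    (∑ ζ ∈ nthRootsFinset N (1 : K), ((PowerSeries.rescale ζ a - a).order.toNat : ℚ)) =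
      ∑ j ∈ Finset.Icc 1 s, ((gcdSeq N H (j - 1) : ℚ) - gcdSeq N H j) * H j := by
  classical
  -- A `ζ` that fixes `a` contributes `0`, since `toNat` sends the infinite order of `0` to `0`; any
  -- other `ζ` is counted at exactly one `j`.
  have h1 : ∀ ζ ∈ nthRootsFinset N (1 : K),
      ((PowerSeries.rescale ζ a - a).order.toNat : ℚ) =
        ∑ j ∈ Finset.Icc 1 s, if PowerSeries.rescale ζ a ≠ a ∧
          (PowerSeries.rescale ζ a - a).order.toNat = H j then (H j : ℚ) else 0 := by
    intro ζ hζ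
    by_cases hne : PowerSeries.rescale ζ a = a
    · simp [hne]
    · obtain ⟨j, hj1, hjs, hj⟩ := horder ζ hζ hne
      rw [Finset.sum_eq_single j]
      · rw [if_pos ⟨hne, hj⟩, hj]
      · intro i hi hij
        rw [Finset.mem_Icc] at hi
        rw [if_neg]
        rintro ⟨-, h2⟩
        rw [hj] at h2
        rcases lt_or_gt_of_ne hij with h3 | h3
        · exact (hmono i j hi.1 h3 hjs).ne' h2
        · exact (hmono j i hj1 h3 hi.2).ne h2
      · intro h2
        exact absurd (Finset.mem_Icc.mpr ⟨hj1, hjs⟩) h2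
  rw [Finset.sum_congr rfl h1, Finset.sum_comm]
  refine Finset.sum_congr rfl fun j hj => ?_
  rw [Finset.mem_Icc] at hj
  obtain ⟨l, rfl⟩ := Nat.exists_eq_add_of_le' hj.1
  rw [← Finset.sum_filter, Finset.sum_const, nsmul_eq_mul, Nat.add_sub_cancel]
  congr 1
  have h2 := card_order_eq hN hcoeff hmono horder hj.2
  rw [eq_sub_iff_add_eq]
  exact_mod_cast h2

end Contact

variable [IsAlgClosed K] [CharZero K] {h : Fin s → ℚ}

theorem term_of_pos {j : ℕ} (hj : 1 ≤ j) (hjs : j ≤ s) : term h j = h ⟨j - 1, by omega⟩ := by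
  obtain ⟨l, rfl⟩ := Nat.exists_eq_add_of_le' hj
  simp only [term, Nat.add_sub_cancel]
  rw [dif_pos (by omega)]

include hN in
/-- The sum of the contacts of `a` with its conjugates, in terms of the characteristic. -/
theorem sum_order_sub_conjugates (hh : StrictMono h)
    (hmem : ∀ r, r ∈ Set.range h ↔ ∃ ζ ∈ nthRootsFinset N (1 : K), PowerSeries.rescale ζ a ≠ a ∧
      ((PowerSeries.rescale ζ a - a).order.toNat : ℚ) / N = r) :
    (∑ b ∈ conjugates N a, ((b - a).order.toNat : ℚ)) =
      N * ∑ j ∈ Finset.Icc 1 s, ((indexProd h (j - 1) : ℚ) - indexProd h j) * term h j := by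
  classical
  have h0 : (N : ℚ) ≠ 0 := by exact_mod_cast hN
  -- Each `N h_j` is the order of some `ζ a - a`, hence an exponent that occurs in `a`.
  have hex : ∀ j, 1 ≤ j → j ≤ s → ∃ m : ℕ, term h j = (m : ℚ) / N ∧ PowerSeries.coeff m a ≠ 0 := by
    intro j hj hjs
    rw [term_of_pos hj hjs]
    obtain ⟨ζ, -, hne, hr⟩ := (hmem _).mp (Set.mem_range_self ⟨j - 1, by omega⟩)
    exact ⟨_, hr.symm, (coeff_order_rescale_sub hne).2⟩
  choose! H hH hcoeff using hex
  have hpos : (0 : ℚ) < N := by exact_mod_cast Nat.pos_of_ne_zero hN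
  have hmono : ∀ i j, 1 ≤ i → i < j → j ≤ s → H i < H j := by
    intro i j hi hij hjs
    have h1 : term h i < term h j := by
      rw [term_of_pos hi (by omega), term_of_pos (by omega) hjs]
      exact hh (Fin.mk_lt_mk.mpr (by omega))
    rw [hH i hi (by omega), hH j (by omega) hjs, div_lt_div_iff_of_pos_right hpos] at h1
    exact_mod_cast h1
  have horder : ∀ ζ ∈ nthRootsFinset N (1 : K), PowerSeries.rescale ζ a ≠ a →
      ∃ j, 1 ≤ j ∧ j ≤ s ∧ (PowerSeries.rescale ζ a - a).order.toNat = H j := by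
    intro ζ hζ hne
    obtain ⟨i, hi⟩ := (hmem _).mpr ⟨ζ, hζ, hne, rfl⟩
    refine ⟨i + 1, by omega, by omega, ?_⟩
    have h1 := hH (i + 1) (by omega) (by omega)
    rw [term_of_pos (by omega) (by omega)] at h1
    have h2 : h i = (H (i + 1) : ℚ) / N := h1
    rw [hi, div_left_inj' h0] at h2
    exact_mod_cast h2
  have hs0 : (gcdSeq N H s : ℚ) ≠ 0 := by exact_mod_cast gcdSeq_ne_zero hN s
  have h1 := sum_mu_eq_card_mul_sum_conjugates hN a (fun b => (b - a).order.toNat)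
  rw [card_stabilizer hN hcoeff horder] at h1
  have h2 : (∑ ζ ∈ nthRootsFinset N (1 : K), ((PowerSeries.rescale ζ a - a).order.toNat : ℚ)) =
      gcdSeq N H s * ∑ b ∈ conjugates N a, ((b - a).order.toNat : ℚ) := by exact_mod_cast h1
  rw [sum_order_eq hN hcoeff hmono horder] at h2
  apply mul_left_cancel₀ hs0
  rw [← h2, ← mul_assoc, Finset.mul_sum]
  refine Finset.sum_congr rfl fun j hj => ?_
  rw [Finset.mem_Icc] at hj
  rw [hH j hj.1 hj.2, ← indexProd_mul_gcdSeq hN hH hj.2,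
    ← indexProd_mul_gcdSeq hN hH (show j - 1 ≤ s by omega)]
  push_cast
  field_simp

end AbhyankarMoh

end

/-! ### Roots of `q` compared with roots of `p`. -/

noncomputable section

open PowerSeries

namespace AbhyankarMoh

open Polynomial (nthRootsFinset)

variable {K : Type*} [Field K] {N : ℕ} (hN : N ≠ 0) {s : ℕ} {h : Fin s → ℚ}

theorem term_le {j : Fin s} (hh : StrictMono h) : h j ≤ term h s := by
  rw [term_of_pos (by have := j.2; omega) le_rfl]
  exact hh.monotone (Fin.mk_le_mk.mpr (by have := j.2; omega))

theorem order_toNat_le_of_order_le {x y : PowerSeries K} (hy : y ≠ 0) (hxy : x.order ≤ y.order) :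
    x.order.toNat ≤ y.order.toNat :=
  ENat.toNat_le_toNat hxy (PowerSeries.order_finite_iff_ne_zero.mpr hy).ne

/-- Comparison of the contacts of a finite set with an arbitrary point and with its point closest
to it. -/
theorem exists_sum_order_sub_le {O : Finset (PowerSeries K)} (hO : O.Nonempty) {b : PowerSeries K}
    {R : ℚ} (hR : ∀ x ∈ O, ((x - b).order.toNat : ℚ) ≤ R) :
    ∃ y ∈ O, ∑ x ∈ O, ((x - b).order.toNat : ℚ) ≤ ∑ x ∈ O, ((x - y).order.toNat : ℚ) + R := by
  classical
  obtain ⟨y, hy, hmax⟩ := Finset.exists_max_image O (fun x => (x - b).order) hO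
  refine ⟨y, hy, ?_⟩
  rw [← Finset.add_sum_erase O (fun x => ((x - b).order.toNat : ℚ)) hy,
    ← Finset.add_sum_erase O (fun x => ((x - y).order.toNat : ℚ)) hy]
  have h1 : ∀ x ∈ O.erase y, ((x - b).order.toNat : ℚ) ≤ ((x - y).order.toNat : ℚ) := by
    intro x hx
    rw [Finset.mem_erase] at hx
    -- By the ultrametric inequality, since `y` is at least as close to `b` as `x` is.
    have h2 : (x - b).order ≤ (x - y).order := by
      have h3 := PowerSeries.min_order_le_order_add (x - b) (-(y - b))
      rw [PowerSeries.order_neg, min_eq_left (hmax x hx.2)] at h3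
      rwa [show x - b + -(y - b) = x - y by ring] at h3
    exact_mod_cast order_toNat_le_of_order_le (sub_ne_zero.mpr hx.1) h2
  have h2 := Finset.sum_le_sum h1
  have h3 := hR y hy
  have h4 : (0 : ℚ) ≤ ((y - y).order.toNat : ℚ) := by positivity
  linarith

/-- Passing from `a` to `b` changes `ζ a - a` by terms of order at least `ord (a - b)`, too high to
affect its order. -/
theorem order_rescale_sub_eq {ζ : K} (hζ : ζ ≠ 0) {a b : PowerSeries K}
    (hab : (PowerSeries.rescale ζ a - a).order < (a - b).order) :
    (PowerSeries.rescale ζ b - b).order = (PowerSeries.rescale ζ a - a).order := by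
  have h1 : (PowerSeries.rescale ζ a - a).order <
      ((a - b) + PowerSeries.rescale ζ (b - a)).order := by
    refine lt_of_lt_of_le (lt_min hab ?_) (PowerSeries.min_order_le_order_add _ _)
    rwa [order_rescale hζ, ← neg_sub a b, PowerSeries.order_neg]
  have h2 : PowerSeries.rescale ζ b - b =
      (PowerSeries.rescale ζ a - a) + ((a - b) + PowerSeries.rescale ζ (b - a)) := by
    rw [map_sub]
    ring
  rw [h2, PowerSeries.order_add_of_order_ne _ _ h1.ne, min_eq_left h1.le]

open Classical in
include hN in
theorem card_mu_eq_card_stabilizer_mul_card_conjugates (a : PowerSeries K) :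
    (nthRootsFinset N (1 : K)).card =
      ((nthRootsFinset N (1 : K)).filter fun ζ => PowerSeries.rescale ζ a = a).card *
        (conjugates N a).card := by
  have := sum_mu_eq_card_mul_sum_conjugates hN a (fun _ => 1)
  simpa using this

/-- Norm of `q` modulo `p` in terms of the contacts of the roots of `p` and `q`. -/
theorem order_norm_eq_sum {p q : Polynomial (PowerSeries K)} {a : PowerSeries K} (hp : p.Monic)
    (hpa : p.map (expandHom K N hN) = orbitPoly N a) (hq : q.Monic)
    (hqs : (q.map (expandHom K N hN)).Splits) :
    N • (Algebra.norm (PowerSeries K) (AdjoinRoot.mk p q)).order =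
      ∑ x ∈ conjugates N a,
        ((q.map (expandHom K N hN)).roots.map fun b => (x - b).order).sum := by
  have hcard : (conjugates N a).card = p.natDegree := by
    rw [← natDegree_orbitPoly, ← hpa, hp.natDegree_map]
  let e := (Finset.equivFinOfCardEq hcard).symm
  have h1 := map_norm_mk_eq_prod (expandHom K N hN) hp (fun i => (e i : PowerSeries K))
    (Subtype.val_injective.comp e.injective) (fun i => by
      have h2 := isRoot_orbitPoly.mpr (e i).2
      rw [← hpa] at h2
      rw [← Polynomial.eval_map]
      exact h2) q
  rw [Fintype.prod_equiv e _
    (fun x : conjugates N a => q.eval₂ (expandHom K N hN) (x : PowerSeries K)) (fun i => rfl),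
    Finset.prod_coe_sort (conjugates N a) (fun x => q.eval₂ (expandHom K N hN) x)] at h1
  have h2 := congrArg PowerSeries.order h1
  rw [PowerSeries.order_prod] at h2
  -- The factor `N` arises because substituting `t ^ N` for `X` multiplies orders by `N`.
  rw [← PowerSeries.order_expand N hN]
  refine h2.trans (Finset.sum_congr rfl fun x _ => ?_)
  rw [← Polynomial.eval_map, hqs.eval_eq_prod_roots_of_monic (hq.map _)]
  induction (Polynomial.map (expandHom K N hN) q).roots using Multiset.induction_on with
  | empty => simp
  | cons b m ih => simp [PowerSeries.order_mul, ih]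

variable [IsAlgClosed K] [CharZero K]

/-- If the intersection number is large then some root of the second polynomial is closer to a root
of the first one than all the conjugates of that root. -/
theorem exists_order_lt_order {p q : Polynomial (PowerSeries K)} {a : PowerSeries K} (hp : p.Monic)
    (hpa : p.map (expandHom K N hN) = orbitPoly N a) (hh : StrictMono h)
    (hc : Set.range h = contacts p) (hq : q.Monic)
    (hqs : (q.map (expandHom K N hN)).Splits)
    (hlt : ∀ m : ℕ, (Algebra.norm (PowerSeries K) (AdjoinRoot.mk p q)).order = m →
      q.natDegree * qExponent h s < m) :
    ∃ x ∈ conjugates N a, ∃ b, (q.map (expandHom K N hN)).IsRoot b ∧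
      ∀ ζ ∈ nthRootsFinset N (1 : K), PowerSeries.rescale ζ x ≠ x →
        (PowerSeries.rescale ζ x - x).order < (x - b).order := by
  by_contra! hcon
  have hNpos : (0 : ℚ) < N := by exact_mod_cast Nat.pos_of_ne_zero hN
  have horb : ∀ x ∈ conjugates N a, p.map (expandHom K N hN) = orbitPoly N x := fun x hx => by
    rw [hpa, orbitPoly, orbitPoly, conjugates_eq_of_mem hN hx]
  have hmem : ∀ x ∈ conjugates N a, ∀ r, r ∈ Set.range h ↔ ∃ ζ ∈ nthRootsFinset N (1 : K),
      PowerSeries.rescale ζ x ≠ x ∧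
        ((PowerSeries.rescale ζ x - x).order.toNat : ℚ) / N = r := fun x hx r => by
    rw [hc]
    exact mem_contacts_iff_of_map_eq_orbitPoly hN hp (horb x hx)
  have hdeg : (q.map (expandHom K N hN)).natDegree = q.natDegree := hq.natDegree_map _
  -- By `hcon`, `ord (x - b)` is at most some finite contact `N h_j` of `x`, hence at most `N h_s`.
  have hbound : ∀ x ∈ conjugates N a, ∀ b, (q.map (expandHom K N hN)).IsRoot b →
      x ≠ b ∧ ((x - b).order.toNat : ℚ) ≤ N * term h s := by
    intro x hx b hb
    obtain ⟨ζ, hζ, hne, hle⟩ := hcon x hx b hb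
    have hne' := sub_ne_zero.mpr hne
    refine ⟨?_, ?_⟩
    · rintro rfl
      rw [sub_self, PowerSeries.order_zero, top_le_iff, PowerSeries.order_eq_top] at hle
      exact hne' hle
    · have h1 := order_toNat_le_of_order_le hne' hle
      obtain ⟨i, hi⟩ := (hmem x hx _).mpr ⟨ζ, hζ, hne, rfl⟩
      have h2 := term_le hh (j := i)
      rw [hi, div_le_iff₀ hNpos, mul_comm] at h2
      exact (by exact_mod_cast h1 : ((x - b).order.toNat : ℚ) ≤ _).trans h2
  have hsum : ∀ b, (q.map (expandHom K N hN)).IsRoot b →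
      ∑ x ∈ conjugates N a, ((x - b).order.toNat : ℚ) ≤ N * qExponent h s := by
    intro b hb
    obtain ⟨y, hy, hle⟩ := exists_sum_order_sub_le ⟨a, self_mem_conjugates hN a⟩
      (fun x hx => (hbound x hx b hb).2)
    refine hle.trans (le_of_eq ?_)
    rw [← conjugates_eq_of_mem hN hy, sum_order_sub_conjugates hN hh (hmem y hy), qExponent,
      ← mul_add]
    -- What is left is the last term of `q_s`, where `e_s = 1` as an empty product.
    congr 2
    simp [indexProd]
  have horder := order_norm_eq_sum hN hp hpa hq hqs
  set B := (q.map (expandHom K N hN)).roots with hB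
  have hroot : ∀ b ∈ B, (q.map (expandHom K N hN)).IsRoot b := fun b hb =>
    Polynomial.isRoot_of_mem_roots hb
  have hcast : ∑ x ∈ conjugates N a, (B.map fun b => (x - b).order).sum =
      ((∑ x ∈ conjugates N a, (B.map fun b => (x - b).order.toNat).sum : ℕ) : ℕ∞) := by
    rw [Nat.cast_sum]
    refine Finset.sum_congr rfl fun x hx => ?_
    rw [Nat.cast_multiset_sum, Multiset.map_map]
    congr 1
    refine Multiset.map_congr rfl fun b hb => ?_
    exact (PowerSeries.coe_toNat_order
      (sub_ne_zero.mpr (hbound x hx b (hroot b hb)).1)).symm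
  rw [hcast] at horder
  obtain ⟨m, hm⟩ : ∃ m : ℕ, (Algebra.norm (PowerSeries K) (AdjoinRoot.mk p q)).order = m := by
    refine ENat.ne_top_iff_exists.mp (fun htop => ?_) |>.imp fun _ => Eq.symm
    rw [htop] at horder
    have : N • (⊤ : ℕ∞) = ⊤ := by
      rw [nsmul_eq_mul]
      exact ENat.mul_top (by exact_mod_cast hN)
    rw [this] at horder
    exact ENat.top_ne_natCast _ horder
  have h1 := hlt m hm
  rw [hm] at horder
  have h2 : N * m = ∑ x ∈ conjugates N a, (B.map fun b => (x - b).order.toNat).sum := by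
    rw [nsmul_eq_mul] at horder
    exact_mod_cast horder
  have h3 : ((N * m : ℕ) : ℚ) =
      (B.map fun b => ∑ x ∈ conjugates N a, ((x - b).order.toNat : ℚ)).sum := by
    rw [h2, Multiset.sum_map_sum, Nat.cast_sum]
    refine Finset.sum_congr rfl fun x _ => ?_
    rw [Nat.cast_multiset_sum, Multiset.map_map]
    rfl
  have h4 : (B.map fun b => ∑ x ∈ conjugates N a, ((x - b).order.toNat : ℚ)).sum ≤
      Multiset.card B • ((N : ℚ) * qExponent h s) := by
    refine (Multiset.sum_le_card_nsmul _ _ fun y hy => ?_).trans (by rw [Multiset.card_map])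
    obtain ⟨b, hb, rfl⟩ := Multiset.mem_map.mp hy
    exact hsum b (hroot b hb)
  rw [← h3, ← hqs.natDegree_eq_card_roots, hdeg, nsmul_eq_mul] at h4
  push_cast at h4
  have h5 := mul_lt_mul_of_pos_left h1 hNpos
  linarith

/-- A polynomial that has a root close enough to a root of an irreducible polynomial of the same
degree is irreducible and has the same contacts. -/
theorem irreducible_and_contacts_eq {p q : Polynomial (PowerSeries K)} {a b : PowerSeries K}
    (hp : p.Monic) (hpa : p.map (expandHom K N hN) = orbitPoly N a) (hq : q.Monic)
    (hdeg : q.natDegree = p.natDegree) (hqb : (q.map (expandHom K N hN)).IsRoot b)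
    (hab : ∀ ζ ∈ nthRootsFinset N (1 : K), PowerSeries.rescale ζ a ≠ a →
      (PowerSeries.rescale ζ a - a).order < (a - b).order) :
    Irreducible q ∧ contacts q = contacts p := by
  classical
  have hstab : ((nthRootsFinset N (1 : K)).filter fun ζ => PowerSeries.rescale ζ b = b) ⊆
      (nthRootsFinset N (1 : K)).filter fun ζ => PowerSeries.rescale ζ a = a := by
    intro ζ hζ
    rw [Finset.mem_filter] at *
    refine ⟨hζ.1, ?_⟩
    by_contra hne
    have h1 := order_rescale_sub_eq (mu_ne_zero hN hζ.1) (hab ζ hζ.1 hne)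
    rw [hζ.2, sub_self, PowerSeries.order_zero, eq_comm, PowerSeries.order_eq_top] at h1
    exact hne (sub_eq_zero.mp h1)
  have hcard : ∀ x : PowerSeries K, N =
      ((nthRootsFinset N (1 : K)).filter fun ζ => PowerSeries.rescale ζ x = x).card *
        (conjugates N x).card := fun x => by
    rw [← card_mu_eq_card_stabilizer_mul_card_conjugates hN, card_mu hN]
  have ha := hcard a
  have hb := hcard b
  have hpos : ∀ x : PowerSeries K,
      0 < ((nthRootsFinset N (1 : K)).filter fun ζ => PowerSeries.rescale ζ x = x).card :=
    fun x => Nat.pos_of_ne_zero fun h0 => hN (by rw [hcard x, h0, zero_mul])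
  have hpa' : p.natDegree = (conjugates N a).card := by
    rw [← natDegree_orbitPoly, ← hpa, hp.natDegree_map]
  have hle := Finset.card_le_card hstab
  -- Both orbits satisfy orbit size times stabilizer size equal to `N`, so the smaller stabilizer
  -- has the larger orbit.
  have hle' : (conjugates N a).card ≤ (conjugates N b).card := by
    by_contra! hlt
    have h1 := Nat.mul_lt_mul_of_le_of_lt hle hlt (hpos a)
    omega
  have hqorb := map_eq_orbitPoly_of_natDegree_le hN hq hqb (by omega)
  have hqb' : q.natDegree = (conjugates N b).card := by
    rw [← natDegree_orbitPoly, ← hqorb, hq.natDegree_map]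
  have hst := Finset.eq_of_subset_of_card_le hstab (by
    rw [← hqb', hdeg, hpa'] at hb
    have h0 : 0 < (conjugates N a).card := Finset.card_pos.mpr ⟨a, self_mem_conjugates hN a⟩
    exact (Nat.eq_of_mul_eq_mul_right h0 (hb.symm.trans ha)).ge)
  refine ⟨irreducible_of_map_eq_orbitPoly hN hq hqorb, ?_⟩
  ext r
  rw [mem_contacts_iff_of_map_eq_orbitPoly hN hq hqorb,
    mem_contacts_iff_of_map_eq_orbitPoly hN hp hpa]
  refine exists_congr fun ζ => and_congr_right fun hζ => ?_
  have h1 : PowerSeries.rescale ζ b = b ↔ PowerSeries.rescale ζ a = a := by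
    have := Finset.ext_iff.mp hst ζ
    simpa [hζ] using this
  rw [ne_eq, ne_eq, h1]
  refine and_congr_right fun hne => ?_
  rw [order_rescale_sub_eq (mu_ne_zero hN hζ) (hab ζ hζ hne)]

end AbhyankarMoh

end

/-! ### The Abhyankar–Moh theorem. -/

theorem mainTheorem4 {K : Type*} [Field K] [IsAlgClosed K] [CharZero K]
    (f g : MvPowerSeries (Fin 2) K) (n s : ℕ) (h : Fin s → ℚ)
    (hf : Irreducible f)
    (hfX : AbhyankarMoh.intersectionNumber f (MvPowerSeries.X 0) = (n : ℕ∞))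
    (hfchar : AbhyankarMoh.IsCharacteristic f h)
    (hgX : AbhyankarMoh.intersectionNumber g (MvPowerSeries.X 0) = (n : ℕ∞))
    (hfg : (((n : ℚ) * AbhyankarMoh.qExponent h s : ℚ) : WithTop ℚ) <
      ENat.map (fun m : ℕ => (m : ℚ)) (AbhyankarMoh.intersectionNumber f g)) :
    Irreducible g ∧ AbhyankarMoh.IsCharacteristic g h := by
  open AbhyankarMoh in
  obtain ⟨hh, p, hpf, hc⟩ := hfchar
  obtain ⟨q, hqg⟩ := exists_isWeierstrassPolynomialOf (f := g) (by rw [hgX]; exact ENat.natCast_ne_top n)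
  have hp := hpf.monic
  have hq := hqg.monic
  have hirr := hpf.irreducible hf
  have hpn : p.natDegree = n := by exact_mod_cast hpf.natDegree_eq.trans hfX
  have hqn : q.natDegree = n := by exact_mod_cast hqg.natDegree_eq.trans hgX
  have hp0 : p.natDegree ≠ 0 := fun h0 =>
    hirr.not_isUnit (by rw [hp.natDegree_eq_zero.mp h0]; exact isUnit_one)
  -- Splitting the product provides a common `N` for `p` and `q`.
  obtain ⟨N, hN, hs⟩ := splitsOverPuiseux (hp.mul hq)
  rw [Polynomial.map_mul, Polynomial.splits_mul (hp.map _).ne_zero (hq.map _).ne_zero] at hs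
  obtain ⟨a, ha⟩ := hs.1.exists_eval_eq_zero (by
    rw [hp.degree_map, Polynomial.degree_eq_natDegree hp.ne_zero]
    exact_mod_cast hp0)
  have hpa := map_eq_orbitPoly_of_irreducible hN hp hirr ha
  obtain ⟨x, hx, b, hb, hxb⟩ := exists_order_lt_order hN hp hpa hh hc hq hs.2 (by
    -- Only a norm of finite order has to be bounded below. Its order `m` makes the intersection
    -- number finite; the case `i_0(f, g) = +∞` is therefore compatible only with a zero norm, for
    -- which there is nothing to check.
    intro m hm
    have h1 := intersectionNumber_le_order_norm hpf hqg hirr (fun h0 => by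
      have hnt : Nontrivial (AdjoinRoot p) := AdjoinRoot.nontrivial p (by
        rw [Polynomial.degree_eq_natDegree hp.ne_zero]
        exact_mod_cast hp0)
      have : Module.Free (PowerSeries K) (AdjoinRoot p) := .of_basis (AdjoinRoot.powerBasis' hp).basis
      have : Module.Finite (PowerSeries K) (AdjoinRoot p) := (AdjoinRoot.powerBasis' hp).finite
      rw [h0, Algebra.norm_zero, PowerSeries.order_zero] at hm
      exact ENat.top_ne_natCast _ hm)
    rw [hm] at h1
    obtain ⟨i, hi⟩ := ENat.ne_top_iff_exists.mp
      (ne_top_of_le_ne_top (ENat.natCast_ne_top m) h1)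
    rw [← hi] at h1 hfg
    rw [ENat.map_natCast, WithTop.coe_lt_coe] at hfg
    rw [hqn]
    refine hfg.trans_le ?_
    exact_mod_cast h1)
  have hpx : p.map (expandHom K N hN) = orbitPoly N x := by
    rw [hpa, orbitPoly, orbitPoly, conjugates_eq_of_mem hN hx]
  obtain ⟨hqirr, hcont⟩ :=
    irreducible_and_contacts_eq hN hp hpx hq (by omega) hb hxb
  exact ⟨hqg.irreducible_of_irreducible hqirr, hh, q, hqg, by rw [hc, hcont]⟩
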